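/- Call a Borel set $B\subset\mathbb{R}$ \emph{measured} if there is a translation invariant Borel measure $\mu$ on $\mathbb{R}$ such that $\mu(B)>0$ and $B$ has $\sigma$-finite $\mu$-measure. A gauge function is a monotone increasing right continuous function $g:[0,\infty)\to[0,\infty)$, and $\mathcal{H}^g$ denotes the corresponding Hausdorff measure on $\mathbb{R}$, $$\mathcal{H}^g(A)=\lim_{\delta\to0+}\inf\Big\{\sum_{i}g(\operatorname{diam}U_i)\,:\,A\subset\bigcup_{i}U_i,\ \operatorname{diam}U_i<\delta\Big\},$$ the infimum being over countable covers by non-empty sets. A set $A\subset\mathbb{R}$ is \emph{measured by a Hausdorff measure} if for some gauge function $g$ we have $\mathcal{H}^g(A)>0$ and $A$ has $\sigma$-finite $\mathcal{H}^g$-measure. There is a compact set $K\subset\mathbb{R}$ which is measured, but is not a union of countably many sets each of which is measured by some Hausdorff measure (the gauge function may depend on the set). Moreover, $K$ can be chosen of the form $K=f(E)$, where $E\subset[0,1]$ is a non-empty compact set of box dimension $0$ which is not a union of countably many measured sets, $f:[0,1]\to\mathbb{R}$ is $C^1$ and bi-Lipschitz, and for a typical $h\in C^1([0,1])$ (that is,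 for all $h$ in a comeagre subset of $C^1([0,1])$ with the $C^1$ norm) the equation $x-y=u-v$ has only trivial solutions in $h(E)$: if $x,y,u,v\in h(E)$ and $x-y=u-v$, then $x=u$ and $y=v$, or $x=y$ and $u=v$. -/

import Mathlib

open Set Filter Topology MeasureTheory
open scoped NNReal ENNReal

noncomputable section

/-- `μ` assigns positive and `σ`-finite measure to `B`. -/
def GivesPosSigmaFinite (μ : Measure ℝ) (B : Set ℝ) : Prop :=
  0 < μ B ∧ SigmaFinite (μ.restrict B)

/-- A Borel set `B ⊆ ℝ` is measured if some translation invariant Borel measure (not required to be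
`σ`-finite or locally finite on `ℝ`) gives it positive and `σ`-finite measure. -/
def Measured (B : Set ℝ) : Prop :=
  MeasurableSet B ∧ ∃ μ : Measure ℝ, μ.IsAddLeftInvariant ∧ GivesPosSigmaFinite μ B

/-- Gauge functions: monotone increasing right continuous `g : [0, ∞) → [0, ∞)`. -/
def IsGauge (g : ℝ≥0 → ℝ≥0) : Prop :=
  Monotone g ∧ ∀ x, ContinuousWithinAt g (Ici x) x

/-- The Hausdorff measure with gauge function `g`: the limit as `δ → 0` of the infimum of
`∑ g (diam Uᵢ)` over countable covers by sets of diameter at most `δ`, see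
`MeasureTheory.Measure.mkMetric_apply`. Empty sets in a cover contribute `0`. The value of the size
function at infinite diameter is immaterial. -/
def gaugeHausdorff (g : ℝ≥0 → ℝ≥0) : Measure ℝ :=
  Measure.mkMetric fun d : ℝ≥0∞ => (g d.toNNReal : ℝ≥0∞)

/-- `A ⊆ ℝ` is measured by some Hausdorff measure. -/
def MeasuredByHausdorff (A : Set ℝ) : Prop :=
  ∃ g : ℝ≥0 → ℝ≥0, IsGauge g ∧ GivesPosSigmaFinite (gaugeHausdorff g) A

/-- `E` is the union of (at most) countably many sets with property `P`. -/
def IsCountableUnionOf (P : Set ℝ → Prop) (E : Set ℝ) : Prop :=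
  ∃ 𝒜 : Set (Set ℝ), 𝒜.Countable ∧ (∀ A ∈ 𝒜, P A) ∧ ⋃₀ 𝒜 = E

/-- The non-empty bounded set `E ⊆ ℝ` has box dimension `d`: `log N(δ) / log (1/δ) → d` as
`δ → 0+`, where `N(δ)` is the least number of closed intervals of radius `δ` covering `E`. -/
def HasBoxDimension (E : Set ℝ) (d : ℝ) : Prop :=
  E.Nonempty ∧ Bornology.IsBounded E ∧
    Tendsto (fun δ : ℝ≥0 =>
        Real.log ((Metric.externalCoveringNumber δ E).toNat : ℝ) / Real.log (1 / (δ : ℝ)))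
      (𝓝[>] 0) (𝓝 d)

/-- The space `C¹([0,1])`: a function `f` is stored as the pair `(f, f')` of continuous functions on
`[0,1]` (the derivative is one-sided at the endpoints, and is determined by `f`). The topology, as a
subspace of `C([0,1]) × C([0,1])`, is that of the `C¹` norm. -/
abbrev C1Unit : Type :=
  {p : C(Icc (0 : ℝ) 1, ℝ) × C(Icc (0 : ℝ) 1, ℝ) //
    ∀ x : Icc (0 : ℝ) 1,
      HasDerivWithinAt (IccExtend zero_le_one p.1) (p.2 x) (Icc (0 : ℝ) 1) (x : ℝ)}

/-- The image `f(E) = {f(x) : x ∈ E}` of a set `E ⊆ [0,1]` under `f ∈ C¹([0,1])`. -/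
def C1Unit.img (f : C1Unit) (E : Set ℝ) : Set ℝ :=
  f.1.1 '' {x : Icc (0 : ℝ) 1 | (x : ℝ) ∈ E}

/-- `f` is bi-Lipschitz on `[0,1]`. -/
def C1Unit.IsBiLipschitz (f : C1Unit) : Prop :=
  ∃ K L : ℝ≥0, LipschitzWith K f.1.1 ∧ AntilipschitzWith L f.1.1

/-- The equation `x - y = u - v` has only trivial solutions in `A`. -/
def OnlyTrivialDifferences (A : Set ℝ) : Prop :=
  ∀ x ∈ A, ∀ y ∈ A, ∀ u ∈ A, ∀ v ∈ A,
    x - y = u - v → (x = u ∧ y = v) ∨ (x = y ∧ u = v)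

end

/-! The set `E` is `digitSet`: the reals whose integer digits, at very sparse binary places, form a
sequence in the unit ball of a weighted `ℓ¹` norm. As long as both sequences stay in the ball,
translating digits means translating reals (`digitReal_add`). So a measured piece of `E` yields a
piece `B k` of the ball and a probability measure `ν k` on digit sequences such that `ν k`-null
subsets of `B k` have only `ν k`-null translates.

Such pieces cannot cover the ball (`not_digitBall_subset_iUnion`). All `ν k` are carried by one set
`C` of sequences with a common tail rate, so every translate of `B k \ C` is `ν k`-null. Conditioned
copies of the `ν k`, translated close to zero, are summed independently; by Fubini every shift of
the random sum almost surely avoids each `B k \ C`. Among uncountably many shifts `floorSeq M t`,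
whose pairwise differences are too large to lie in `C - C`, some shift makes the sum almost surely
avoid `C` as well. This gives an uncovered point of the ball.

The set `E` is so thin that `E⁴` is `ℋ¹`-null. By Baire category and perturbations `h + s g`, where
the bad `s` form a Lipschitz image of a part of `E⁴`, a typical `C¹` image of `E` has only trivial
differences (`eventually_residual_onlyTrivialDifferences`), and some such `f` is bi-Lipschitz. Then
`K = f(E)` meets each of its other translates in at most one point, so the translates of a diffuse
probability measure on `K` add up to an invariant measure giving `K` mass `1`. On the line,
Hausdorff measures change by at most a bounded factor under bi-Lipschitz maps
(`gaugeHausdorff_image_le`). Hence a decomposition of `K` into sets measured by Hausdorff measures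
would pull back to a decomposition of `E` into measured sets. -/

/-! ### Countable covers of the unit ball of integer sequences. -/

/-- The tail `∑_{n ≥ m} |a n| / 2 ^ n` of the weighted `ℓ¹` norm of an integer sequence. -/
noncomputable def weightedTail (m : ℕ) (a : ℕ → ℤ) : ℝ≥0∞ :=
  ∑' n, ((a (n + m)).natAbs : ℝ≥0∞) / 2 ^ (n + m)

/-- The unit ball of the weighted `ℓ¹` norm on integer sequences. -/
def digitBall : Set (ℕ → ℤ) := {a | weightedTail 0 a ≤ 1}

lemma weightedTail_add_le (m : ℕ) (a b : ℕ → ℤ) :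
    weightedTail m (a + b) ≤ weightedTail m a + weightedTail m b := by
  unfold weightedTail
  rw [← ENNReal.tsum_add]
  refine ENNReal.tsum_le_tsum fun n => ?_
  rw [← ENNReal.add_div]
  gcongr
  exact_mod_cast Int.natAbs_add_le _ _

lemma weightedTail_neg (m : ℕ) (a : ℕ → ℤ) : weightedTail m (-a) = weightedTail m a := by
  simp [weightedTail]

lemma weightedTail_sub_le (m : ℕ) (a b : ℕ → ℤ) :
    weightedTail m (a - b) ≤ weightedTail m a + weightedTail m b := by
  rw [sub_eq_add_neg, ← weightedTail_neg m b]
  exact weightedTail_add_le m a (-b)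

lemma natAbs_div_le_weightedTail {m n : ℕ} (h : m ≤ n) (a : ℕ → ℤ) :
    ((a n).natAbs : ℝ≥0∞) / 2 ^ n ≤ weightedTail m a := by
  obtain ⟨k, rfl⟩ := Nat.exists_eq_add_of_le' h
  exact ENNReal.le_tsum (f := fun n => ((a (n + m)).natAbs : ℝ≥0∞) / 2 ^ (n + m)) k

lemma weightedTail_eq_add_succ (m : ℕ) (a : ℕ → ℤ) :
    weightedTail m a = ((a m).natAbs : ℝ≥0∞) / 2 ^ m + weightedTail (m + 1) a := by
  unfold weightedTail
  rw [tsum_eq_zero_add' ENNReal.summable, zero_add]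
  congr 1
  refine tsum_congr fun n => ?_
  rw [show n + 1 + m = n + (m + 1) by ring]

lemma weightedTail_antitone (a : ℕ → ℤ) : Antitone fun m => weightedTail m a :=
  antitone_nat_of_succ_le fun m => by
    rw [weightedTail_eq_add_succ m]
    exact le_add_self

lemma measurable_weightedTail (m : ℕ) : Measurable (weightedTail m) := by
  unfold weightedTail
  refine Measurable.tsum fun n => Measurable.div_const ?_ _
  exact (measurable_of_countable fun z : ℤ => (z.natAbs : ℝ≥0∞)).comp (measurable_pi_apply _)

lemma tendsto_weightedTail {a : ℕ → ℤ} (h : weightedTail 0 a ≠ ∞) :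
    Tendsto (fun m => weightedTail m a) atTop (𝓝 0) :=
  ENNReal.tendsto_sum_nat_add (fun n => ((a n).natAbs : ℝ≥0∞) / 2 ^ n) h

lemma weightedTail_zero_eq_of_prefix_eq_zero {m : ℕ} {a : ℕ → ℤ} (h : ∀ i < m, a i = 0) :
    weightedTail 0 a = weightedTail m a := by
  induction m with
  | zero => rfl
  | succ m ih =>
    rw [ih fun i hi => h i (by omega), weightedTail_eq_add_succ m, h m (by omega)]
    simp

/-- The sets decrease in `m`, and their intersection misses every sequence of finite norm. -/
lemma tendsto_measure_weightedTail_gt (ν : Measure (ℕ → ℤ)) [IsFiniteMeasure ν]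
    (hν : ∀ᵐ a ∂ν, weightedTail 0 a ≤ 1) {c : ℝ≥0∞} (hc : 0 < c) :
    Tendsto (fun m => ν {a | c < weightedTail m a}) atTop (𝓝 0) := by
  have h := tendsto_measure_iInter_atTop (μ := ν) (s := fun m => {a | c < weightedTail m a})
    (fun m => (measurableSet_lt measurable_const (measurable_weightedTail m)).nullMeasurableSet)
    (fun m n hmn a ha => lt_of_lt_of_le ha (weightedTail_antitone a hmn))
    ⟨0, measure_ne_top _ _⟩
  have h0 : ν (⋂ m, {a | c < weightedTail m a}) = 0 := by
    refine measure_mono_null (fun a ha => ?_) hν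
    intro h1
    have h2 := tendsto_weightedTail (a := a) (ne_top_of_le_ne_top ENNReal.one_ne_top h1)
    obtain ⟨m, hm⟩ := (h2.eventually_lt_const hc).exists
    exact (lt_asymm hm (mem_iInter.1 ha m))
  rwa [h0] at h

/-- Countably many measures on the unit ball are simultaneously concentrated on the sequences whose
tails decay at a prescribed rate along a suitable subsequence. -/
lemma exists_common_tail_rate (ν : ℕ → Measure (ℕ → ℤ)) [∀ k, IsFiniteMeasure (ν k)]
    (hν : ∀ k, ∀ᵐ a ∂ν k, weightedTail 0 a ≤ 1) :
    ∃ M : ℕ → ℕ, StrictMono M ∧ (∀ i, 2 * i + 3 ≤ M i) ∧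
      ∀ k, ∀ᵐ a ∂ν k, ∀ᶠ i in atTop, weightedTail (M i) a ≤ (1 / 16) ^ i := by
  have h : ∀ i : ℕ, ∀ᶠ m in atTop, 2 * i + 3 ≤ m ∧
      ∀ k ∈ Finset.range (i + 1), ν k {a | (1 / 16) ^ i < weightedTail m a} < (1 / 2) ^ i := by
    intro i
    refine (eventually_ge_atTop _).and ((Finset.eventually_all _).2 fun k _ => ?_)
    exact (tendsto_measure_weightedTail_gt (ν k) (hν k)
      (ENNReal.pow_pos (by norm_num) _)).eventually_lt_const (ENNReal.pow_pos (by norm_num) _)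
  obtain ⟨M, hM, hM'⟩ := extraction_forall_of_eventually h
  refine ⟨M, hM, fun i => (hM' i).1, fun k => ?_⟩
  -- Stage `i` controls only the measures with index at most `i`, so Borel–Cantelli for `ν k` starts
  -- at stage `k`.
  have hs : ∑' i, ν k {a | (1 / 16) ^ (i + k) < weightedTail (M (i + k)) a} ≠ ∞ := by
    refine ne_top_of_le_ne_top (b := ∑' i, (1 / 2 : ℝ≥0∞) ^ i) ?_ (ENNReal.tsum_le_tsum fun i => ?_)
    · simp [ENNReal.tsum_geometric]
    · refine ((hM' (i + k)).2 k (by simp)).le.trans ?_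
      exact pow_le_pow_right_of_le_one' (by norm_num) (by omega)
  filter_upwards [ae_eventually_notMem hs] with a ha
  have := (tendsto_sub_atTop_nat k).eventually ha
  filter_upwards [this, eventually_ge_atTop k] with i hi hk
  simpa [Nat.sub_add_cancel hk] using hi

/-- Almost every sequence has a tail of size at most `η` after some finite prefix, and there are
countably many prefixes. So one prefix occurs with positive probability; condition on it and
subtract it. Nullity of all translates survives both operations. -/
lemma exists_small_translate (ν : Measure (ℕ → ℤ)) [IsProbabilityMeasure ν]
    (hν : ∀ᵐ a ∂ν, weightedTail 0 a ≤ 1) {η : ℝ≥0∞} (hη : 0 < η) :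
    ∃ ν' : Measure (ℕ → ℤ), IsProbabilityMeasure ν' ∧ (∀ᵐ y ∂ν', weightedTail 0 y ≤ η) ∧
      ∀ N, MeasurableSet N → (∀ w, ν {a | a + w ∈ N} = 0) → ∀ w, ν' {y | y + w ∈ N} = 0 := by
  let A : (Σ m : ℕ, Fin m → ℤ) → Set (ℕ → ℤ) := fun p =>
    {a | weightedTail p.1 a ≤ η} ∩ {a | ∀ i : Fin p.1, a i = p.2 i}
  have hA : ∀ p, MeasurableSet (A p) := fun p =>
    (measurableSet_le (measurable_weightedTail _) measurable_const).inter
      (by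
        simp only [ofPred_forall]
        exact MeasurableSet.iInter fun i =>
          measurableSet_eq_fun (measurable_pi_apply _) measurable_const)
  have hU : ν (⋃ p, A p) ≠ 0 := by
    intro h0
    have h1 : ∀ᵐ a ∂ν, a ∉ ⋃ p, A p := measure_eq_zero_iff_ae_notMem.1 h0
    obtain ⟨a, ha, ha'⟩ := (hν.and h1).exists
    obtain ⟨m, hm⟩ := ((tendsto_weightedTail
      (ne_top_of_le_ne_top ENNReal.one_ne_top ha)).eventually_lt_const hη).exists
    exact ha' (mem_iUnion.2 ⟨⟨m, fun i => a i⟩, hm.le, fun i => rfl⟩)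
  obtain ⟨⟨m, σ⟩, hp⟩ := exists_measure_pos_of_not_measure_iUnion_null hU
  let c : ℕ → ℤ := fun n => if h : n < m then σ ⟨n, h⟩ else 0
  have hprob : IsProbabilityMeasure (ProbabilityTheory.cond ν (A ⟨m, σ⟩)) :=
    ProbabilityTheory.cond_isProbabilityMeasure hp.ne'
  have hsub : Measurable fun a : ℕ → ℤ => a - c := by fun_prop
  refine ⟨(ProbabilityTheory.cond ν (A ⟨m, σ⟩)).map fun a => a - c,
    Measure.isProbabilityMeasure_map hsub.aemeasurable, ?_, ?_⟩
  · rw [ae_map_iff hsub.aemeasurable (measurableSet_le (measurable_weightedTail _) measurable_const)]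
    filter_upwards [ProbabilityTheory.ae_cond_mem (hA ⟨m, σ⟩)] with a ha
    rw [weightedTail_zero_eq_of_prefix_eq_zero (m := m)]
    · refine le_trans (le_of_eq ?_) ha.1
      unfold weightedTail
      refine tsum_congr fun n => ?_
      simp [c]
    · intro i hi
      have := ha.2 ⟨i, hi⟩
      simp only at this
      simp [c, hi, this]
  · intro N hN h w
    have hNw : MeasurableSet {y : ℕ → ℤ | y + w ∈ N} :=
      (show Measurable fun y : ℕ → ℤ => y + w by fun_prop) hN
    rw [Measure.map_apply hsub hNw]
    refine ProbabilityTheory.cond_absolutelyContinuous ?_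
    convert h (w - c) using 2
    ext a
    change a - c + w ∈ N ↔ a + (w - c) ∈ N
    rw [show a - c + w = a + (w - c) by abel]

/-- Resampling one coordinate independently preserves the product measure; this lets Fubini be
applied to coordinate `k` alone. -/
lemma infinitePi_map_update {X : ℕ → Type*} [∀ k, MeasurableSpace (X k)]
    (μ : ∀ k, Measure (X k)) [∀ k, IsProbabilityMeasure (μ k)] (k : ℕ) :
    ((Measure.infinitePi μ).prod (μ k)).map (fun p => Function.update p.1 k p.2) =
      Measure.infinitePi μ := by
  have hm : Measurable fun p : (∀ k, X k) × X k => Function.update p.1 k p.2 := by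
    refine measurable_pi_iff.2 fun i => ?_
    by_cases h : i = k
    · subst h; simpa using measurable_snd
    · simp only [Function.update_of_ne h]; fun_prop
  refine Measure.eq_infinitePi μ fun s t ht => ?_
  rw [Measure.map_apply hm (MeasurableSet.pi s.countable_toSet fun i _ => ht i)]
  by_cases hk : k ∈ s
  · have : (fun p : (∀ k, X k) × X k => Function.update p.1 k p.2) ⁻¹' (s : Set ℕ).pi t =
        (((s.erase k : Finset ℕ) : Set ℕ).pi t) ×ˢ (t k) := by
      ext ⟨ω, y⟩
      simp only [mem_preimage, Set.mem_pi, mem_prod, Finset.coe_erase, Set.mem_sdiff,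
        mem_singleton_iff, Finset.mem_coe]
      constructor
      · intro h
        refine ⟨fun i hi => ?_, by simpa using h k hk⟩
        simpa [Function.update_of_ne hi.2] using h i hi.1
      · rintro ⟨h1, h2⟩ i hi
        by_cases h : i = k
        · subst h; simpa using h2
        · simpa [Function.update_of_ne h] using h1 i ⟨hi, h⟩
    rw [this, Measure.prod_prod, Measure.infinitePi_pi μ fun i _ => ht i, mul_comm,
      Finset.mul_prod_erase s (fun i => μ i (t i)) hk]
  · have : (fun p : (∀ k, X k) × X k => Function.update p.1 k p.2) ⁻¹' (s : Set ℕ).pi t =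
        ((s : Set ℕ).pi t) ×ˢ univ := by
      ext ⟨ω, y⟩
      simp only [mem_preimage, Set.mem_pi, mem_prod, Finset.mem_coe, mem_univ, and_true]
      refine forall₂_congr fun i hi => ?_
      rw [Function.update_of_ne (by rintro rfl; exact hk hi)]
    rw [this, Measure.prod_prod, Measure.infinitePi_pi μ fun i _ => ht i, measure_univ, mul_one]

/-- The integer sequence with entry `⌊t 2 ^ i⌋ 2 ^ (M i - 2 i - 3)` at the place `M i`. -/
noncomputable def floorSeq (M : ℕ → ℕ) (t : ℝ) : ℕ → ℤ :=
  Function.extend M (fun i => ⌊t * 2 ^ i⌋ * 2 ^ (M i - 2 * i - 3)) 0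

/-- It follows that the entry of `floorSeq M t` at `M i` has weight `⌊t 2 ^ i⌋ 4 ^ (-i) / 8`. For
`t` in `[0,1]` this is at most `2 ^ (-i) / 8`, which is summable, whereas for `t < u` the two
weights eventually differ by at least `4 ^ (-i) / 8`, far above `16 ^ (-i)`. -/
lemma two_pow_sub_div {i n : ℕ} (h : 2 * i + 3 ≤ n) :
    (2 : ℝ≥0∞) ^ (n - 2 * i - 3) / 2 ^ n = (1 / 4) ^ i / 8 := by
  obtain ⟨k, rfl⟩ := Nat.exists_eq_add_of_le h
  rw [show 2 * i + 3 + k - 2 * i - 3 = k by omega]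
  rw [ENNReal.div_eq_div_iff (by norm_num) (by norm_num) (by simp) (by simp)]
  have : (4 : ℝ≥0∞) ^ i * (1 / 4) ^ i = 1 := by
    rw [← mul_pow, ENNReal.mul_div_cancel (by norm_num) (by norm_num), one_pow]
  calc (8 : ℝ≥0∞) * 2 ^ k = (4 ^ i * (1 / 4) ^ i) * (8 * 2 ^ k) := by rw [this, one_mul]
    _ = 2 ^ (2 * i + 3 + k) * (1 / 4) ^ i := by
      rw [pow_add, pow_add, pow_mul]; norm_num; ring

lemma weightedTail_floorSeq_le {M : ℕ → ℕ} (hM : StrictMono M) (hM' : ∀ i, 2 * i + 3 ≤ M i)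
    {t : ℝ} (ht : t ∈ Icc (0 : ℝ) 1) : weightedTail 0 (floorSeq M t) ≤ 1 / 4 := by
  have h1 : weightedTail 0 (floorSeq M t) =
      ∑' n, Function.extend M (fun i => ((floorSeq M t (M i)).natAbs : ℝ≥0∞) / 2 ^ M i) 0 n := by
    unfold weightedTail
    refine tsum_congr fun n => ?_
    by_cases h : ∃ i, M i = n
    · obtain ⟨i, rfl⟩ := h
      rw [hM.injective.extend_apply]; simp
    · rw [Function.extend_apply' _ _ _ h]
      simp [floorSeq, Function.extend_apply' _ _ _ h]
  rw [h1, tsum_extend_zero hM.injective]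
  have h2 : ∀ i, ((floorSeq M t (M i)).natAbs : ℝ≥0∞) / 2 ^ M i ≤ (1 / 2) ^ i / 8 := by
    intro i
    have h3 : (⌊t * 2 ^ i⌋).natAbs ≤ 2 ^ i := by
      have h4 : (0 : ℤ) ≤ ⌊t * 2 ^ i⌋ := Int.floor_nonneg.2 (by have := ht.1; positivity)
      have h5 : ⌊t * 2 ^ i⌋ ≤ (2 : ℤ) ^ i := by
        have : t * 2 ^ i ≤ 2 ^ i := mul_le_of_le_one_left (by positivity) ht.2
        have := (Int.floor_le _).trans this
        exact_mod_cast this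
      zify
      rw [abs_of_nonneg h4]
      exact h5
    rw [floorSeq, hM.injective.extend_apply, Int.natAbs_mul, Int.natAbs_pow]
    calc (((⌊t * 2 ^ i⌋).natAbs * (2 : ℤ).natAbs ^ (M i - 2 * i - 3) : ℕ) : ℝ≥0∞) / 2 ^ M i
        ≤ ((2 ^ i * 2 ^ (M i - 2 * i - 3) : ℕ) : ℝ≥0∞) / 2 ^ M i := by gcongr; norm_num
      _ = 2 ^ i * ((2 : ℝ≥0∞) ^ (M i - 2 * i - 3) / 2 ^ M i) := by push_cast; rw [mul_div_assoc]
      _ = (1 / 2) ^ i / 8 := by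
        rw [two_pow_sub_div (hM' i), ← mul_div_assoc, ← mul_pow]
        congr 2
        rw [show (4 : ℝ≥0∞) = 2 * 2 by norm_num, one_div, one_div,
          ENNReal.mul_inv (by simp) (by simp), ← mul_assoc,
          ENNReal.mul_inv_cancel (by simp) (by simp), one_mul]
  refine (ENNReal.tsum_le_tsum h2).trans ?_
  simp only [div_eq_mul_inv, one_mul]
  rw [ENNReal.tsum_mul_right, ENNReal.tsum_geometric, ENNReal.one_sub_inv_two, inv_inv]
  rw [show (8 : ℝ≥0∞) = 2 * 4 by norm_num, ENNReal.mul_inv (by simp) (by simp), ← mul_assoc,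
    ENNReal.mul_inv_cancel (by simp) (by simp), one_mul]

lemma not_tail_rate_floorSeq_sub {M : ℕ → ℕ} (hM : StrictMono M) (hM' : ∀ i, 2 * i + 3 ≤ M i)
    {t u : ℝ} (htu : t < u) :
    ¬ ∀ᶠ i in atTop, weightedTail (M i) (floorSeq M u - floorSeq M t) ≤ 2 * (1 / 16) ^ i := by
  intro h
  have h1 : ∀ᶠ i : ℕ in atTop, 1 ≤ (u - t) * 2 ^ i := by
    have := (tendsto_pow_atTop_atTop_of_one_lt (one_lt_two (α := ℝ))).const_mul_atTop
      (sub_pos.2 htu)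
    exact this.eventually_ge_atTop 1
  -- From `i = 3` on, `4 ^ (-i) / 8` exceeds `2 * 16 ^ (-i)`.
  obtain ⟨i, hi, hi1, hi3⟩ := (h.and (h1.and (eventually_ge_atTop 3))).exists
  have h2 : 1 ≤ ⌊u * 2 ^ i⌋ - ⌊t * 2 ^ i⌋ := by
    have : ⌊t * 2 ^ i + 1⌋ ≤ ⌊u * 2 ^ i⌋ := Int.floor_le_floor (by linarith)
    rw [Int.floor_add_one] at this
    omega
  have h3 : (2 : ℕ) ^ (M i - 2 * i - 3) ≤ ((floorSeq M u - floorSeq M t) (M i)).natAbs := by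
    rw [Pi.sub_apply, floorSeq, floorSeq, hM.injective.extend_apply, hM.injective.extend_apply,
      ← sub_mul, Int.natAbs_mul, Int.natAbs_pow]
    exact Nat.le_mul_of_pos_left _ (by omega)
  have h4 : (1 / 4 : ℝ≥0∞) ^ i / 8 ≤ 2 * (1 / 16) ^ i := by
    rw [← two_pow_sub_div (hM' i)]
    refine le_trans ?_ ((natAbs_div_le_weightedTail le_rfl _).trans hi)
    gcongr
    exact_mod_cast h3
  have h5 : (1 / 4 : ℝ) ^ i / 8 ≤ 2 * (1 / 16) ^ i := by
    have := ENNReal.toReal_mono (by finiteness) h4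
    simpa using this
  rw [show (1 / 16 : ℝ) = 1 / 4 * (1 / 4) by norm_num, mul_pow] at h5
  have h6 : (1 / 4 : ℝ) ^ i ≤ (1 / 4) ^ 3 := pow_le_pow_of_le_one (by norm_num) (by norm_num) hi3
  have h7 : 0 < (1 / 4 : ℝ) ^ i := by positivity
  norm_num at h6
  nlinarith

/-- The sum of a sequence of integer sequences, the `k`-th of which starts at the place `k`. -/
def diagSum (ω : ℕ → ℕ → ℤ) : ℕ → ℤ := fun n => ∑ k ∈ Finset.range (n + 1), ω k n

lemma measurable_diagSum : Measurable diagSum := by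
  unfold diagSum
  refine measurable_pi_iff.2 fun n => ?_
  fun_prop

lemma weightedTail_diagSum_le (ω : ℕ → ℕ → ℤ) :
    weightedTail 0 (diagSum ω) ≤ ∑' k, weightedTail 0 (ω k) := by
  unfold weightedTail
  rw [ENNReal.tsum_comm]
  refine ENNReal.tsum_le_tsum fun n => ?_
  calc ((diagSum ω (n + 0)).natAbs : ℝ≥0∞) / 2 ^ (n + 0)
      ≤ ((∑ k ∈ Finset.range (n + 0 + 1), (ω k (n + 0)).natAbs : ℕ) : ℝ≥0∞) / 2 ^ (n + 0) := by
        gcongr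
        exact Int.natAbs_sum_le _ _
    _ = ∑ k ∈ Finset.range (n + 0 + 1), ((ω k (n + 0)).natAbs : ℝ≥0∞) / 2 ^ (n + 0) := by
        push_cast
        simp only [div_eq_mul_inv, Finset.sum_mul]
    _ ≤ _ := ENNReal.sum_le_tsum _

/-- A nonzero integer at place `n` already weighs `2 ^ (-n)`. Hence a summand of norm at most `2 ^
(-(k + 1))` loses nothing when `diagSum` ignores its first `k` entries. -/
lemma eq_zero_of_weightedTail_le {k n : ℕ} (h : n ≤ k) {a : ℕ → ℤ}
    (ha : weightedTail 0 a ≤ (1 / 2) ^ (k + 1)) : a n = 0 := by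
  by_contra h0
  have h1 : (1 : ℝ≥0∞) ≤ (a n).natAbs := by exact_mod_cast Int.natAbs_pos.2 h0
  have h2 : (1 / 2 : ℝ≥0∞) ^ n ≤ (1 / 2) ^ (k + 1) := by
    refine le_trans ?_ ((natAbs_div_le_weightedTail (Nat.zero_le n) a).trans ha)
    rw [one_div, ← ENNReal.inv_pow, ← one_div]
    gcongr
  have h3 := ENNReal.toReal_mono (by finiteness) h2
  simp only [one_div, ENNReal.toReal_pow, ENNReal.toReal_inv, ENNReal.toReal_ofNat] at h3
  have h4 := (pow_lt_pow_iff_right_of_lt_one₀ (a := (2 : ℝ)⁻¹) (by norm_num) (by norm_num)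
    (m := k + 1) (n := n)).2 (by omega)
  linarith

lemma diagSum_update (ω : ℕ → ℕ → ℤ) (k : ℕ) (y : ℕ → ℤ) (hy : ∀ n < k, y n = 0) :
    diagSum (Function.update ω k y) = y + diagSum (Function.update ω k 0) := by
  ext n
  simp only [diagSum, Pi.add_apply]
  by_cases hk : k ∈ Finset.range (n + 1)
  · rw [← Finset.add_sum_erase _ _ hk, ← Finset.add_sum_erase _ _ hk]
    simp only [Function.update_self, Pi.zero_apply, zero_add, add_right_inj]
    refine Finset.sum_congr rfl fun i hi => ?_
    rw [Function.update_of_ne (Finset.ne_of_mem_erase hi),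
      Function.update_of_ne (Finset.ne_of_mem_erase hi)]
  · rw [hy n (by simpa using hk), zero_add]
    refine Finset.sum_congr rfl fun i hi => ?_
    have : i ≠ k := by rintro rfl; exact hk hi
    rw [Function.update_of_ne this, Function.update_of_ne this]

/-- With all coordinates but the `k`-th frozen, the sum is `y` plus a fixed sequence, so each
section is a `ν k`-null translate of `N`. -/
lemma infinitePi_diagSum_add_mem_eq_zero (ν : ℕ → Measure (ℕ → ℤ)) [∀ k, IsProbabilityMeasure (ν k)]
    {k : ℕ} (hk : ∀ᵐ y ∂ν k, weightedTail 0 y ≤ (1 / 2) ^ (k + 1)) {N : Set (ℕ → ℤ)}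
    (hN : MeasurableSet N) (h : ∀ w, ν k {y | y + w ∈ N} = 0) (z : ℕ → ℤ) :
    Measure.infinitePi ν {ω | diagSum ω + z ∈ N} = 0 := by
  have hmeas : MeasurableSet {ω | diagSum ω + z ∈ N} :=
    (show Measurable fun ω => diagSum ω + z from measurable_diagSum.add_const z) hN
  have hup : Measurable fun p : (ℕ → ℕ → ℤ) × (ℕ → ℤ) => Function.update p.1 k p.2 := by
    refine measurable_pi_iff.2 fun i => ?_
    by_cases h : i = k
    · subst h; simpa using measurable_snd
    · simp only [Function.update_of_ne h]; fun_prop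
  rw [← infinitePi_map_update ν k, Measure.map_apply hup hmeas,
    Measure.measure_prod_null (hup hmeas)]
  refine Eventually.of_forall fun ω => ?_
  refine measure_mono_null (t := {y | ¬ weightedTail 0 y ≤ (1 / 2) ^ (k + 1)} ∪
    {y | y + (diagSum (Function.update ω k 0) + z) ∈ N}) (fun y hy => ?_)
    (measure_union_null hk (h _))
  by_cases hy' : weightedTail 0 y ≤ (1 / 2) ^ (k + 1)
  · right
    change diagSum (Function.update ω k y) + z ∈ N at hy
    rwa [diagSum_update ω k y fun n hn => eq_zero_of_weightedTail_le hn.le hy', add_assoc] at hy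
  · exact Or.inl hy'

/-- The unit ball of the weighted `ℓ¹` norm on integer sequences is not covered by countably many
sets `B k`, each of which carries a probability measure whose null subsets of `B k` remain null
after translation. -/
theorem not_digitBall_subset_iUnion (B : ℕ → Set (ℕ → ℤ)) (hB : ∀ k, MeasurableSet (B k))
    (ν : ℕ → Measure (ℕ → ℤ)) [∀ k, IsProbabilityMeasure (ν k)]
    (hν : ∀ k, ∀ᵐ a ∂ν k, weightedTail 0 a ≤ 1)
    (hinv : ∀ k, ∀ N, MeasurableSet N → N ⊆ B k → ν k N = 0 → ∀ w, ν k {a | a + w ∈ N} = 0) :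
    ¬ digitBall ⊆ ⋃ k, B k := by
  intro hcov
  obtain ⟨M, hM, hM', hrate⟩ := exists_common_tail_rate ν hν
  let C : Set (ℕ → ℤ) := {a | ∀ᶠ i in atTop, weightedTail (M i) a ≤ (1 / 16) ^ i}
  have hC : MeasurableSet C := by
    have : C = ⋃ j, ⋂ i, ⋂ (_ : j ≤ i), {a | weightedTail (M i) a ≤ (1 / 16) ^ i} := by
      ext a
      simp only [mem_iUnion, mem_iInter]
      exact eventually_atTop
    rw [this]
    exact MeasurableSet.iUnion fun j => MeasurableSet.iInter fun i => MeasurableSet.iInter fun _ =>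
      measurableSet_le (measurable_weightedTail _) measurable_const
  -- These radii add up to `1 / 2`, leaving room in the ball for the shift, of norm at most `1 / 4`.
  have hpos : ∀ k : ℕ, (0 : ℝ≥0∞) < (1 / 2) ^ (k + 2) := fun k => ENNReal.pow_pos (by norm_num) _
  choose ν' hν'prob hν' hν'null using fun k => exists_small_translate (ν k) (hν k) (hpos k)
  have hN : ∀ k, MeasurableSet (B k \ C) := fun k => (hB k).diff hC
  have hN0 : ∀ k w, ν' k {y | y + w ∈ B k \ C} = 0 := fun k =>
    hν'null k _ (hN k) (hinv k _ (hN k) sdiff_subset (measure_mono_null (fun a ha => ha.2) (hrate k)))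
  have hmeasC : ∀ t, MeasurableSet {ω | diagSum ω + floorSeq M t ∈ C} := fun t =>
    (show Measurable fun ω => diagSum ω + floorSeq M t from measurable_diagSum.add_const _) hC
  -- For a finite measure, only countably many of the disjoint events indexed by `t` have positive
  -- measure.
  obtain ⟨t, ht, htC⟩ : ∃ t ∈ Icc (0 : ℝ) 1,
      Measure.infinitePi ν' {ω | diagSum ω + floorSeq M t ∈ C} = 0 := by
    have hdisj : ∀ t u, t < u → Disjoint {ω | diagSum ω + floorSeq M t ∈ C}
        {ω | diagSum ω + floorSeq M u ∈ C} := by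
      intro t u htu
      refine Set.disjoint_left.2 fun ω h1 h2 => not_tail_rate_floorSeq_sub hM hM' htu ?_
      filter_upwards [h1, h2] with i h3 h4
      rw [show floorSeq M u - floorSeq M t =
        (diagSum ω + floorSeq M u) - (diagSum ω + floorSeq M t) by abel, two_mul]
      exact (weightedTail_sub_le _ _ _).trans (add_le_add h4 h3)
    have hcount := Measure.countable_meas_pos_of_disjoint_iUnion (μ := Measure.infinitePi ν')
      hmeasC (fun t u htu => by
        rcases lt_or_gt_of_ne htu with h | h
        · exact hdisj t u h
        · exact (hdisj u t h).symm)
    by_contra! hne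
    refine Cardinal.Real.Icc_countable_iff.not.2 (not_le.2 (zero_lt_one (α := ℝ))) ?_
    exact hcount.mono fun t ht => pos_iff_ne_zero.2 (hne t ht)
  have hsmall : ∀ᵐ ω ∂Measure.infinitePi ν', ∀ k, weightedTail 0 (ω k) ≤ (1 / 2) ^ (k + 2) := by
    refine ae_all_iff.2 fun k => ?_
    have := (measurePreserving_eval_infinitePi ν' k).quasiMeasurePreserving.ae (hν' k)
    exact this
  have hgood : ∀ᵐ ω ∂Measure.infinitePi ν', ∀ k, diagSum ω + floorSeq M t ∉ B k \ C :=
    ae_all_iff.2 fun k => measure_eq_zero_iff_ae_notMem.1 <|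
      infinitePi_diagSum_add_mem_eq_zero ν' (k := k) ((hν' k).mono fun y hy => hy.trans
        (pow_le_pow_right_of_le_one' (by norm_num) (by omega))) (hN k) (hN0 k) (floorSeq M t)
  obtain ⟨ω, h1, h2, h3⟩ := (hsmall.and (hgood.and (measure_eq_zero_iff_ae_notMem.1 htC))).exists
  have hball : diagSum ω + floorSeq M t ∈ digitBall := by
    refine (weightedTail_add_le _ _ _).trans ((add_le_add ((weightedTail_diagSum_le ω).trans
      (ENNReal.tsum_le_tsum h1)) (weightedTail_floorSeq_le hM hM' ht)).trans ?_)
    simp only [pow_add]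
    rw [ENNReal.tsum_mul_right, one_div, ENNReal.tsum_geometric, ENNReal.one_sub_inv_two, inv_inv,
      pow_two, ← mul_assoc, ENNReal.mul_inv_cancel (by simp) (by simp), one_mul]
    refine (add_le_add (le_refl _) (?_ : _ ≤ (2⁻¹ : ℝ≥0∞))).trans ENNReal.inv_two_add_inv_two.le
    rw [one_div]
    exact ENNReal.inv_le_inv.2 (by norm_num)
  obtain ⟨k, hk⟩ := mem_iUnion.1 (hcov hball)
  exact h2 k ⟨hk, h3⟩

/-! ### The compact set of reals with digits in the ball. -/

/-- The rapidly decreasing place values of the digit expansion. -/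
noncomputable def placeValue (n : ℕ) : ℝ := (1 / 2) ^ (n + 2) ^ 3

/-- The real number with the given (integer) digits, shifted by `1 / 2`. -/
noncomputable def digitReal (a : ℕ → ℤ) : ℝ := 1 / 2 + ∑' n, (a n : ℝ) * placeValue n

/-- The reals whose digits form a sequence in the unit ball `digitBall`. -/
def digitSet : Set ℝ := digitReal '' digitBall

/-- A bound for the part of the digit expansion that starts at the place `n`. -/
noncomputable def tailRadius (n : ℕ) : ℝ := 2 ^ (n + 1) * placeValue n

lemma placeValue_pos (n : ℕ) : 0 < placeValue n := by unfold placeValue; positivity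

lemma tailRadius_pos (n : ℕ) : 0 < tailRadius n :=
  mul_pos (by positivity) (placeValue_pos n)

lemma placeValue_succ_le (n : ℕ) : placeValue (n + 1) ≤ placeValue n * (1 / 2) ^ (n + 5) := by
  unfold placeValue
  rw [← pow_add]
  exact pow_le_pow_of_le_one (by norm_num) (by norm_num) (by ring_nf; nlinarith)

lemma two_pow_mul_placeValue_add_le (n k : ℕ) :
    2 ^ (k + n) * placeValue (k + n) ≤ 2 ^ n * placeValue n * (1 / 2) ^ k := by
  induction k with
  | zero => simp
  | succ k ih =>
    have h1 := placeValue_succ_le (k + n)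
    have h2 : (1 / 2 : ℝ) ^ (k + n + 5) ≤ (1 / 2) ^ 2 :=
      pow_le_pow_of_le_one (by norm_num) (by norm_num) (by omega)
    have h3 := placeValue_pos (k + n)
    calc (2 : ℝ) ^ (k + 1 + n) * placeValue (k + 1 + n)
        = 2 * (2 ^ (k + n) * placeValue (k + n + 1)) := by
          rw [show k + 1 + n = k + n + 1 by ring]; ring
      _ ≤ 2 * (2 ^ (k + n) * (placeValue (k + n) * (1 / 2) ^ 2)) := by
          gcongr
          exact h1.trans (by gcongr)
      _ = 2 ^ (k + n) * placeValue (k + n) * (1 / 2) := by ring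
      _ ≤ 2 ^ n * placeValue n * (1 / 2) ^ k * (1 / 2) := by gcongr
      _ = _ := by ring

lemma summable_digits {a : ℕ → ℤ} {c : ℝ} (h : ∀ n, |(a n : ℝ)| ≤ c * 2 ^ n) :
    Summable fun n => (a n : ℝ) * placeValue n := by
  have hc : 0 ≤ c := by simpa using (abs_nonneg _).trans (h 0)
  refine Summable.of_norm_bounded (g := fun n => c * (placeValue 0 * (1 / 2) ^ n))
    ((summable_geometric_two.mul_left _).mul_left _) fun n => ?_
  rw [norm_mul, Real.norm_eq_abs, Real.norm_eq_abs, abs_of_pos (placeValue_pos n)]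
  have := two_pow_mul_placeValue_add_le 0 n
  simp only [add_zero, pow_zero, one_mul] at this
  calc |(a n : ℝ)| * placeValue n ≤ c * 2 ^ n * placeValue n := by
        gcongr
        · exact (placeValue_pos n).le
        · exact h n
    _ = c * (2 ^ n * placeValue n) := by ring
    _ ≤ _ := by gcongr

lemma abs_tsum_digits_le {a : ℕ → ℤ} {c : ℝ} (h : ∀ n, |(a n : ℝ)| ≤ c * 2 ^ n) (n : ℕ) :
    |∑' k, (a (k + n) : ℝ) * placeValue (k + n)| ≤ c * tailRadius n := by
  have hc : 0 ≤ c := by simpa using (abs_nonneg _).trans (h 0)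
  have hs : HasSum (fun k : ℕ => c * (2 ^ n * placeValue n) * (1 / 2) ^ k)
      (c * (2 ^ n * placeValue n) * 2) := hasSum_geometric_two.mul_left _
  have := tsum_of_norm_bounded hs (f := fun k => (a (k + n) : ℝ) * placeValue (k + n)) fun k => by
    rw [norm_mul, Real.norm_eq_abs, Real.norm_eq_abs, abs_of_pos (placeValue_pos _)]
    calc |(a (k + n) : ℝ)| * placeValue (k + n) ≤ c * 2 ^ (k + n) * placeValue (k + n) := by
          gcongr
          · exact (placeValue_pos _).le
          · exact h _
      _ = c * (2 ^ (k + n) * placeValue (k + n)) := by ring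
      _ ≤ c * (2 ^ n * placeValue n * (1 / 2) ^ k) := by
          gcongr c * ?_; exact two_pow_mul_placeValue_add_le n k
      _ = _ := by ring
  refine this.trans (le_of_eq ?_)
  unfold tailRadius; ring

lemma natAbs_le_of_mem_digitBall {a : ℕ → ℤ} (ha : a ∈ digitBall) (n : ℕ) :
    (a n).natAbs ≤ 2 ^ n := by
  have h := (natAbs_div_le_weightedTail (Nat.zero_le n) a).trans ha
  rw [ENNReal.div_le_iff (by simp) (by simp), one_mul] at h
  exact_mod_cast h

lemma abs_le_of_mem_digitBall {a : ℕ → ℤ} (ha : a ∈ digitBall) (n : ℕ) :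
    |(a n : ℝ)| ≤ 1 * 2 ^ n := by
  rw [one_mul, ← Int.cast_abs, Int.abs_eq_natAbs]
  exact_mod_cast natAbs_le_of_mem_digitBall ha n

lemma abs_sub_le_of_mem_digitBall {a b : ℕ → ℤ} (ha : a ∈ digitBall) (hb : b ∈ digitBall) (n : ℕ) :
    |((a - b) n : ℝ)| ≤ 2 * 2 ^ n := by
  have h1 := abs_le_of_mem_digitBall ha n
  have h2 := abs_le_of_mem_digitBall hb n
  rw [Pi.sub_apply, Int.cast_sub]
  exact (abs_sub _ _).trans (by linarith)

lemma digitReal_sub {a b : ℕ → ℤ} (ha : a ∈ digitBall) (hb : b ∈ digitBall) :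
    digitReal a - digitReal b = ∑' n, ((a - b) n : ℝ) * placeValue n := by
  unfold digitReal
  rw [add_sub_add_left_eq_sub, ← (summable_digits (abs_le_of_mem_digitBall ha)).tsum_sub
    (summable_digits (abs_le_of_mem_digitBall hb))]
  refine tsum_congr fun n => ?_
  simp [sub_mul]

lemma abs_digitReal_sub_le {a b : ℕ → ℤ} (ha : a ∈ digitBall) (hb : b ∈ digitBall) {n : ℕ}
    (h : ∀ i < n, a i = b i) : |digitReal a - digitReal b| ≤ 2 * tailRadius n := by
  have hs := summable_digits (abs_sub_le_of_mem_digitBall ha hb)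
  rw [digitReal_sub ha hb, ← hs.sum_add_tsum_nat_add n, Finset.sum_eq_zero, zero_add]
  · exact abs_tsum_digits_le (abs_sub_le_of_mem_digitBall ha hb) n
  · intro i hi
    simp [h i (Finset.mem_range.1 hi)]

/-- At the first place `n` where the digits differ, they contribute at least `placeValue n`, while
all later places together contribute at most a quarter of it. -/
lemma digitReal_injOn : InjOn digitReal digitBall := by
  intro a ha b hb hab
  by_contra hne
  have hex : ∃ n, a n ≠ b n := Function.ne_iff.1 hne
  classical
  let n := Nat.find hex
  have hn : a n ≠ b n := Nat.find_spec hex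
  have hlt : ∀ i < n, a i = b i := fun i hi => not_not.1 (Nat.find_min hex hi)
  have hbd := abs_sub_le_of_mem_digitBall ha hb
  have hs := summable_digits hbd
  have h0 := digitReal_sub ha hb
  rw [hab, sub_self, ← hs.sum_add_tsum_nat_add (n + 1), Finset.sum_range_succ, Finset.sum_eq_zero
    (fun i hi => by simp [hlt i (Finset.mem_range.1 hi)]), zero_add] at h0
  have h1 := abs_tsum_digits_le hbd (n + 1)
  have h2 : placeValue n ≤ |((a - b) n : ℝ) * placeValue n| := by
    rw [abs_mul, abs_of_pos (placeValue_pos n)]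
    refine le_mul_of_one_le_left (placeValue_pos n).le ?_
    rw [← Int.cast_abs]
    exact_mod_cast Int.one_le_abs (sub_ne_zero.2 hn)
  have h3 : 2 * tailRadius (n + 1) ≤ placeValue n / 4 := by
    unfold tailRadius
    calc 2 * (2 ^ (n + 1 + 1) * placeValue (n + 1))
        ≤ 2 * (2 ^ (n + 1 + 1) * (placeValue n * (1 / 2) ^ (n + 5))) := by
          gcongr; exact placeValue_succ_le n
      _ = (2 ^ n * (1 / 2) ^ n) * (placeValue n / 4) := by ring
      _ = placeValue n / 4 := by rw [← mul_pow]; norm_num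
  have h4 := placeValue_pos n
  rw [eq_neg_of_add_eq_zero_left h0.symm, abs_neg] at h2
  linarith

lemma isClosed_digitBall : IsClosed digitBall := by
  have : digitBall = ⋂ s : Finset ℕ, {a | ∑ n ∈ s, ((a (n + 0)).natAbs : ℝ≥0∞) / 2 ^ (n + 0) ≤ 1} := by
    ext a
    simp only [mem_iInter]
    change weightedTail 0 a ≤ 1 ↔ _
    rw [weightedTail, ENNReal.tsum_eq_iSup_sum, iSup_le_iff]
    rfl
  rw [this]
  refine isClosed_iInter fun s => isClosed_le ?_ continuous_const
  refine continuous_finsetSum _ fun n _ => ?_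
  refine (ENNReal.continuous_div_const _ (by simp)).comp ?_
  exact (continuous_of_discreteTopology (f := fun z : ℤ => (z.natAbs : ℝ≥0∞))).comp
    (continuous_apply _)

lemma isCompact_digitBall : IsCompact digitBall := by
  refine (isCompact_univ_pi (s := fun n : ℕ => Icc (-2 ^ n : ℤ) (2 ^ n))
    fun n => (Set.finite_Icc _ _).isCompact).of_isClosed_subset isClosed_digitBall ?_
  intro a ha n _
  have := natAbs_le_of_mem_digitBall ha n
  zify at this
  exact ⟨(abs_le.1 this).1, (abs_le.1 this).2⟩

lemma continuousOn_digitReal : ContinuousOn digitReal digitBall := by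
  refine continuousOn_const.add (continuousOn_tsum (u := fun n => placeValue 0 * (1 / 2) ^ n)
    (fun n => ?_) (summable_geometric_two.mul_left _) fun n a ha => ?_)
  · exact (((continuous_of_discreteTopology (f := fun z : ℤ => (z : ℝ))).comp
      (continuous_apply n)).mul continuous_const).continuousOn
  · rw [norm_mul, Real.norm_eq_abs, Real.norm_eq_abs, abs_of_pos (placeValue_pos n)]
    have := two_pow_mul_placeValue_add_le 0 n
    simp only [add_zero, pow_zero, one_mul] at this
    refine le_trans ?_ this
    have h := abs_le_of_mem_digitBall ha n
    rw [one_mul] at h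
    gcongr
    exact (placeValue_pos n).le

lemma isCompact_digitSet : IsCompact digitSet :=
  isCompact_digitBall.image_of_continuousOn continuousOn_digitReal

lemma digitSet_subset_Icc : digitSet ⊆ Icc 0 1 := by
  rintro _ ⟨a, ha, rfl⟩
  have := abs_tsum_digits_le (abs_le_of_mem_digitBall ha) 0
  have h2 : 1 * tailRadius 0 ≤ 1 / 2 := by norm_num [tailRadius, placeValue]
  have h3 := abs_le.1 (this.trans h2)
  simp only [add_zero] at h3
  constructor <;> unfold digitReal <;> linarith [h3.1, h3.2]

lemma zero_mem_digitBall : (0 : ℕ → ℤ) ∈ digitBall := by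
  change weightedTail 0 0 ≤ 1
  simp [weightedTail]

lemma digitSet_nonempty : digitSet.Nonempty := ⟨_, 0, zero_mem_digitBall, rfl⟩

/-- The digits of an element of `digitSet`, and the zero sequence for other reals. -/
noncomputable def digits : ℝ → ℕ → ℤ := by
  classical exact digitSet.piecewise (Function.invFunOn digitReal digitBall) 0

lemma digits_mem {x : ℝ} (hx : x ∈ digitSet) : digits x ∈ digitBall := by
  classical
  rw [digits, piecewise_eq_of_mem _ _ _ hx]
  exact Function.invFunOn_mem hx

lemma digitReal_digits {x : ℝ} (hx : x ∈ digitSet) : digitReal (digits x) = x := by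
  classical
  rw [digits, piecewise_eq_of_mem _ _ _ hx]
  exact Function.invFunOn_eq hx

lemma digits_digitReal {a : ℕ → ℤ} (ha : a ∈ digitBall) : digits (digitReal a) = a :=
  digitReal_injOn (digits_mem ⟨a, ha, rfl⟩) ha (digitReal_digits ⟨a, ha, rfl⟩)

/-- A continuous injection on a compact set is a closed map onto its image. -/
lemma continuousOn_digits : ContinuousOn digits digitSet := by
  refine continuousOn_iff_isClosed.2 fun t ht => ⟨digitReal '' (digitBall ∩ t), ?_, ?_⟩
  · exact ((isCompact_digitBall.inter_right ht).image_of_continuousOn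
      (continuousOn_digitReal.mono inter_subset_left)).isClosed
  · ext x
    constructor
    · rintro ⟨h1, h2⟩
      exact ⟨⟨digits x, ⟨digits_mem h2, h1⟩, digitReal_digits h2⟩, h2⟩
    · rintro ⟨⟨a, ⟨ha, hat⟩, rfl⟩, h2⟩
      exact ⟨by simpa [mem_preimage, digits_digitReal ha] using hat, h2⟩

lemma measurable_digits : Measurable digits := by
  classical
  have h : ContinuousOn (Function.invFunOn digitReal digitBall) digitSet := by
    refine continuousOn_digits.congr fun x hx => ?_
    rw [digits, piecewise_eq_of_mem _ _ _ hx]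
  unfold digits
  convert h.measurable_piecewise (g := 0) continuousOn_const isCompact_digitSet.measurableSet

lemma measurable_digitReal : Measurable digitReal := by
  refine Measurable.const_add (Measurable.tsum fun n => ?_) _
  exact ((measurable_of_countable fun z : ℤ => (z : ℝ)).comp (measurable_pi_apply n)).mul_const _

lemma digitReal_add {a w : ℕ → ℤ} (ha : a ∈ digitBall) (haw : a + w ∈ digitBall) :
    digitReal (a + w) = (∑' n, (w n : ℝ) * placeValue n) + digitReal a := by
  have := digitReal_sub haw ha
  rw [add_sub_cancel_left] at this
  linarith

/-- `digitSet` is not a union of countably many measured sets. -/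
theorem not_isCountableUnionOf_measured_digitSet : ¬ IsCountableUnionOf Measured digitSet := by
  rintro ⟨𝒜, hc, hm, hU⟩
  have hne : 𝒜.Nonempty := by
    by_contra h
    rw [not_nonempty_iff_eq_empty.1 h, sUnion_empty] at hU
    exact digitSet_nonempty.ne_empty hU.symm
  obtain ⟨B, rfl⟩ := hc.exists_eq_range hne
  have hBm : ∀ k, Measured (B k) := fun k => hm _ ⟨k, rfl⟩
  have hBE : ∀ k, B k ⊆ digitSet := fun k => hU ▸ subset_sUnion_of_mem ⟨k, rfl⟩
  choose hBmeas μ hinv hpos hsf using hBm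
  have hne0 : ∀ k, NeZero ((μ k).restrict (B k)) := fun k =>
    ⟨by rw [Ne, Measure.restrict_eq_zero]; exact (hpos k).ne'⟩
  -- Only null sets matter, so the `σ`-finite restriction may be replaced by an equivalent
  -- probability measure.
  let ρ : ℕ → Measure ℝ := fun k => ((μ k).restrict (B k)).toFinite
  have hρ : ∀ k, IsProbabilityMeasure (ρ k) := fun k => by
    dsimp only [ρ]; infer_instance
  have hρ1 : ∀ k, ρ k ≪ (μ k).restrict (B k) := fun k => toFinite_absolutelyContinuous _
  have hρ2 : ∀ k, (μ k).restrict (B k) ≪ ρ k := fun k => absolutelyContinuous_toFinite _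
  have hν : ∀ k, IsProbabilityMeasure ((ρ k).map digits) := fun k =>
    Measure.isProbabilityMeasure_map measurable_digits.aemeasurable
  refine not_digitBall_subset_iUnion (fun k => digitReal ⁻¹' (B k) ∩ digitBall)
    (fun k => (measurable_digitReal (hBmeas k)).inter isClosed_digitBall.measurableSet)
    (fun k => (ρ k).map digits) ?_ ?_ ?_
  · intro k
    rw [ae_map_iff measurable_digits.aemeasurable
      (measurableSet_le (measurable_weightedTail _) measurable_const)]
    refine (hρ1 k).ae_le ?_
    filter_upwards [ae_restrict_mem (hBmeas k)] with x hx
    exact digits_mem (hBE k hx)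
  · intro k N hN hNB hN0 w
    have hNw : MeasurableSet {a : ℕ → ℤ | a + w ∈ N} :=
      (show Measurable fun a : ℕ → ℤ => a + w by fun_prop) hN
    rw [Measure.map_apply measurable_digits hN] at hN0
    rw [Measure.map_apply measurable_digits hNw]
    refine hρ1 k ?_
    have h0 := hρ2 k hN0
    rw [Measure.restrict_apply (measurable_digits hN)] at h0
    rw [Measure.restrict_apply (measurable_digits hNw)]
    have := hinv k
    -- If the series of `w` diverges, the sum has the default value `0`. This is harmless: any point
    -- of the set to be bounded has both `digits x` and `digits x + w` in `digitBall`, which forces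
    -- convergence.
    rw [← measure_preimage_add (μ k) (∑' n, (w n : ℝ) * placeValue n)] at h0
    refine measure_mono_null ?_ h0
    rintro x ⟨hx1, hx2⟩
    change digits x + w ∈ N at hx1
    have h1 := hNB hx1
    have h2 := digitReal_add (digits_mem (hBE k hx2)) h1.2
    rw [digitReal_digits (hBE k hx2)] at h2
    refine ⟨?_, ?_⟩
    · change digits (_ + x) ∈ N
      rw [← h2, digits_digitReal h1.2]
      exact hx1
    · change _ + x ∈ B k
      rw [← h2]; exact h1.1
  · intro a ha
    have : digitReal a ∈ ⋃₀ range B := hU ▸ ⟨a, ha, rfl⟩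
    obtain ⟨_, ⟨k, rfl⟩, hk⟩ := this
    exact mem_iUnion.2 ⟨k, hk, ha⟩

/-! ### Covering numbers, box dimension and codes of the digit set. -/

/-- The centres are the digit prefixes of length `n`. The exponent of their number is quadratic in
`n`, that of `tailRadius n` is cubic; both thinness properties of `digitSet` rest on this gap. -/
lemma exists_finset_cover_digitSet (n : ℕ) : ∃ C : Finset ℝ, C.card ≤ 2 ^ (n * (n + 1)) ∧
    ∀ x ∈ digitSet, ∃ c ∈ C, |x - c| ≤ tailRadius n := by
  classical
  refine ⟨(Fintype.piFinset fun i : Fin n => Finset.Icc (-2 ^ (i : ℕ) : ℤ) (2 ^ (i : ℕ))).image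
    fun σ => 1 / 2 + ∑ i : Fin n, (σ i : ℝ) * placeValue i, ?_, ?_⟩
  · refine Finset.card_image_le.trans ?_
    rw [Fintype.card_piFinset]
    calc ∏ i : Fin n, (Finset.Icc (-2 ^ (i : ℕ) : ℤ) (2 ^ (i : ℕ))).card
        ≤ ∏ i : Fin n, 2 ^ (n + 1) := by
          refine Finset.prod_le_prod' fun i _ => ?_
          rw [Int.card_Icc]
          have h1 : (2 : ℤ) ^ (i : ℕ) + 1 - -2 ^ (i : ℕ) ≤ 2 ^ (n + 1) := by
            have h2 : (2 : ℤ) ^ ((i : ℕ) + 1) ≤ 2 ^ n := pow_le_pow_right₀ (by norm_num) i.2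
            have h3 : (1 : ℤ) ≤ 2 ^ n := one_le_pow₀ (by norm_num)
            rw [pow_succ] at h2 ⊢
            linarith
          have := Int.toNat_le_toNat h1
          refine this.trans (le_of_eq ?_)
          norm_cast
      _ = 2 ^ (n * (n + 1)) := by simp [← pow_mul, mul_comm]
  · rintro _ ⟨a, ha, rfl⟩
    refine ⟨_, Finset.mem_image.2 ⟨fun i => a i, ?_, rfl⟩, ?_⟩
    · refine Fintype.mem_piFinset.2 fun i => Finset.mem_Icc.2 ?_
      have := natAbs_le_of_mem_digitBall ha i
      zify at this
      exact abs_le.1 this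
    · have hbd := abs_le_of_mem_digitBall ha
      have := abs_tsum_digits_le hbd n
      rw [one_mul] at this
      convert this using 2
      rw [digitReal, ← (summable_digits hbd).sum_add_tsum_nat_add n,
        Finset.sum_range (fun i => (a i : ℝ) * placeValue i)]
      ring

lemma tailRadius_le (n : ℕ) : tailRadius n ≤ (1 / 2) ^ ((n + 1) * ((n + 1) * (n + 2))) := by
  unfold tailRadius placeValue
  obtain ⟨k, hk⟩ : ∃ k, (n + 2) ^ 3 = (n + 1) + ((n + 1) * ((n + 1) * (n + 2)) + k) :=
    ⟨(n + 2) * (2 * n + 3) - (n + 1), by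
      have : n + 1 ≤ (n + 2) * (2 * n + 3) := by nlinarith
      zify [this]; ring⟩
  rw [hk, pow_add (1 / 2 : ℝ) (n + 1), pow_add (1 / 2 : ℝ) _ k, ← mul_assoc, ← mul_pow]
  norm_num only [one_pow, one_mul]
  exact mul_le_of_le_one_right (by positivity) (pow_le_one₀ (by norm_num) (by norm_num))

lemma tendsto_tailRadius : Tendsto tailRadius atTop (𝓝 0) := by
  refine squeeze_zero (fun n => (tailRadius_pos n).le) (fun n => (tailRadius_le n).trans ?_)
    (tendsto_pow_atTop_nhds_zero_of_lt_one (r := (1 / 2 : ℝ)) (by norm_num) (by norm_num))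
  exact pow_le_pow_of_le_one (by norm_num) (by norm_num)
    ((Nat.le_succ n).trans (Nat.le_mul_of_pos_right _ (by positivity)))

lemma externalCoveringNumber_digitSet_le {n : ℕ} {δ : ℝ≥0} (h : tailRadius n ≤ δ) :
    (Metric.externalCoveringNumber δ digitSet).toNat ≤ 2 ^ (n * (n + 1)) := by
  obtain ⟨C, hC, hcov⟩ := exists_finset_cover_digitSet n
  have hcov' : Metric.IsCover δ digitSet (C : Set ℝ) := by
    intro x hx
    obtain ⟨c, hc, hxc⟩ := hcov x hx
    refine ⟨c, hc, ?_⟩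
    change edist x c ≤ δ
    rw [edist_nndist]
    exact_mod_cast (show dist x c ≤ δ from hxc.trans h)
  refine ENat.toNat_le_of_le_natCast (hcov'.externalCoveringNumber_le_encard.trans ?_)
  rw [Set.encard_coe_eq_coe_finsetCard]
  exact_mod_cast hC

/-- For `tailRadius (n + 1) ≤ δ < tailRadius n` the quotient is at most `(n + 1) (n + 2) / ((n + 1)
^ 2 (n + 2)) = 1 / (n + 1)`. -/
theorem hasBoxDimension_digitSet : HasBoxDimension digitSet 0 := by
  refine ⟨digitSet_nonempty, isCompact_digitSet.isBounded, ?_⟩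
  refine Metric.tendsto_nhds.2 fun η hη => ?_
  obtain ⟨n₀, hn₀⟩ := exists_nat_one_div_lt hη
  have hmem : Ioo (0 : ℝ≥0) ⟨tailRadius n₀, (tailRadius_pos n₀).le⟩ ∈ 𝓝[>] (0 : ℝ≥0) :=
    Ioo_mem_nhdsGT (tailRadius_pos n₀)
  filter_upwards [hmem] with δ hδ
  have hδ0 : (0 : ℝ) < δ := hδ.1
  have hδ1 : (δ : ℝ) < tailRadius n₀ := hδ.2
  obtain ⟨n, hn, hn1, hn2⟩ : ∃ n, n₀ ≤ n ∧ tailRadius (n + 1) ≤ δ ∧ δ < tailRadius n := by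
    have hex : ∃ k, tailRadius (n₀ + (k + 1)) ≤ δ := by
      have := (tendsto_tailRadius.comp (tendsto_add_atTop_nat (n₀ + 1))).eventually_le_const hδ0
      obtain ⟨k, hk⟩ := this.exists
      exact ⟨k, by
        rw [show n₀ + (k + 1) = k + (n₀ + 1) by ring]
        exact hk⟩
    classical
    refine ⟨n₀ + Nat.find hex, by omega, Nat.find_spec hex, ?_⟩
    rcases h : Nat.find hex with _ | k
    · simpa using hδ1
    · exact not_le.1 (Nat.find_min hex (m := k) (by omega))
  have hl2 : 0 < Real.log 2 := Real.log_pos (by norm_num)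
  have hden : (n + 1 : ℝ) * ((n + 1) * (n + 2)) * Real.log 2 ≤ Real.log (1 / δ) := by
    have h1 := hn2.le.trans (tailRadius_le n)
    have h2 := Real.log_le_log hδ0 h1
    rw [Real.log_pow, one_div, Real.log_inv] at h2
    rw [one_div, Real.log_inv]
    push_cast at h2
    linarith
  have hnum : Real.log ((Metric.externalCoveringNumber δ digitSet).toNat : ℝ) ≤
      (n + 1) * (n + 2) * Real.log 2 := by
    have h1 := externalCoveringNumber_digitSet_le hn1
    rcases Nat.eq_zero_or_pos (Metric.externalCoveringNumber δ digitSet).toNat with h0 | h0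
    · rw [h0]; simp only [Nat.cast_zero, Real.log_zero]; positivity
    · have h2 : ((Metric.externalCoveringNumber δ digitSet).toNat : ℝ) ≤
          2 ^ ((n + 1) * (n + 1 + 1)) := by exact_mod_cast h1
      have h3 := Real.log_le_log (by exact_mod_cast h0) h2
      rw [Real.log_pow] at h3
      push_cast at h3
      linarith
  have hpos : 0 < Real.log (1 / δ) := lt_of_lt_of_le (by positivity) hden
  rw [Real.dist_eq, sub_zero, abs_of_nonneg (div_nonneg (Real.log_natCast_nonneg _) hpos.le),
    div_lt_iff₀ hpos]
  have h5 : 1 < η * (n + 1) := by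
    rw [div_lt_iff₀ (by positivity)] at hn₀
    refine hn₀.trans_le ?_
    gcongr
  have h6 : 0 < (n + 1 : ℝ) * (n + 2) * Real.log 2 := by positivity
  calc Real.log ((Metric.externalCoveringNumber δ digitSet).toNat : ℝ)
      ≤ (n + 1) * (n + 2) * Real.log 2 := hnum
    _ < η * (n + 1) * ((n + 1) * (n + 2) * Real.log 2) := lt_mul_of_one_lt_left h6 h5
    _ = η * ((n + 1 : ℝ) * ((n + 1) * (n + 2)) * Real.log 2) := by ring
    _ ≤ η * Real.log (1 / δ) := by gcongr

/-- The fourth power of the number of prefixes, times `2 * tailRadius n`, is still at most `2 ^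
(-n)`. -/
lemma hausdorffMeasure_one_digitSet_prod :
    μH[1] (digitSet ×ˢ digitSet ×ˢ digitSet ×ˢ digitSet) = 0 := by
  choose C hC hcov using exists_finset_cover_digitSet
  let r : ℕ → ℝ≥0∞ := fun n => ENNReal.ofReal (2 * tailRadius n)
  have hr : Tendsto r atTop (𝓝 0) := by
    have := ENNReal.tendsto_ofReal (tendsto_tailRadius.const_mul 2)
    simpa [r] using this
  let t : ∀ n, ↥(C n ×ˢ C n ×ˢ C n ×ˢ C n) → Set (ℝ × ℝ × ℝ × ℝ) := fun n c =>
    Metric.closedBall (c : ℝ × ℝ × ℝ × ℝ) (tailRadius n)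
  have hdiam : ∀ n i, Metric.ediam (t n i) ≤ r n := fun n i => by
    refine Metric.ediam_le_of_forall_dist_le fun x hx y hy => ?_
    refine (dist_triangle_right x y (i : ℝ × ℝ × ℝ × ℝ)).trans ?_
    have h1 : dist x i ≤ _ := hx
    have h2 : dist y i ≤ _ := hy
    linarith
  have h := Measure.hausdorffMeasure_le_liminf_sum 1
    (digitSet ×ˢ digitSet ×ˢ digitSet ×ˢ digitSet) (l := atTop) r hr t
    (Eventually.of_forall hdiam) (Eventually.of_forall fun n => ?_)
  · refine le_antisymm (h.trans (le_of_eq (Tendsto.liminf_eq ?_))) (zero_le)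
    refine tendsto_of_tendsto_of_tendsto_of_le_of_le tendsto_const_nhds (h := fun n =>
      ENNReal.ofReal ((1 / 2) ^ n)) ?_ (fun n => zero_le) fun n => ?_
    · have := ENNReal.tendsto_ofReal (tendsto_pow_atTop_nhds_zero_of_lt_one
        (r := (1 / 2 : ℝ)) (by norm_num) (by norm_num))
      simpa using this
    · simp only [ENNReal.rpow_one]
      calc ∑ i, Metric.ediam (t n i) ≤ ∑ i : ↥(C n ×ˢ C n ×ˢ C n ×ˢ C n), r n :=
            Finset.sum_le_sum fun i _ => hdiam n i
        _ = ((C n ×ˢ C n ×ˢ C n ×ˢ C n).card : ℝ≥0∞) * r n := by simp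
        _ = ENNReal.ofReal ((C n ×ˢ C n ×ˢ C n ×ˢ C n).card * (2 * tailRadius n)) := by
            rw [ENNReal.ofReal_mul (by positivity), ENNReal.ofReal_natCast]
        _ ≤ ENNReal.ofReal ((1 / 2) ^ n) := ?_
      refine ENNReal.ofReal_le_ofReal ?_
      have hcard : ((C n ×ˢ C n ×ˢ C n ×ˢ C n).card : ℝ) ≤ 2 ^ (4 * (n * (n + 1))) := by
        rw [Finset.card_product, Finset.card_product, Finset.card_product]
        have h1 : ((C n).card : ℝ) ≤ 2 ^ (n * (n + 1)) := by exact_mod_cast hC n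
        push_cast
        calc ((C n).card : ℝ) * ((C n).card * ((C n).card * (C n).card))
            ≤ 2 ^ (n * (n + 1)) * (2 ^ (n * (n + 1)) * (2 ^ (n * (n + 1)) * 2 ^ (n * (n + 1)))) := by
              gcongr
          _ = _ := by rw [← pow_add, ← pow_add, ← pow_add]; congr 1; ring
      calc ((C n ×ˢ C n ×ˢ C n ×ˢ C n).card : ℝ) * (2 * tailRadius n)
          ≤ 2 ^ (4 * (n * (n + 1))) * (2 * (1 / 2) ^ ((n + 1) * ((n + 1) * (n + 2)))) := by
            gcongr
            · have := tailRadius_pos n; positivity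
            · exact tailRadius_le n
        _ ≤ 2 ^ (4 * (n * (n + 1))) * (2 * (1 / 2) ^ (4 * (n * (n + 1)) + (n + 1))) := by
            gcongr ?_ * (?_ * ?_)
            refine pow_le_pow_of_le_one (by norm_num) (by norm_num) ?_
            have : 3 * n ≤ n * n + 2 + 1 * n := by nlinarith [sq_nonneg ((n : ℤ) - 1)]
            nlinarith
        _ = (2 ^ (4 * (n * (n + 1))) * (1 / 2) ^ (4 * (n * (n + 1)))) * (1 / 2) ^ n := by
            rw [pow_add, pow_succ]; ring
        _ = (1 / 2) ^ n := by rw [← mul_pow]; norm_num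
  · rintro ⟨x, y, u, v⟩ ⟨hx, hy, hu, hv⟩
    obtain ⟨c1, h1, h1'⟩ := hcov n x hx
    obtain ⟨c2, h2, h2'⟩ := hcov n y hy
    obtain ⟨c3, h3, h3'⟩ := hcov n u hu
    obtain ⟨c4, h4, h4'⟩ := hcov n v hv
    refine mem_iUnion.2 ⟨⟨(c1, c2, c3, c4), by simp [h1, h2, h3, h4]⟩, ?_⟩
    simp only [t, Metric.mem_closedBall, Prod.dist_eq, Real.dist_eq, sup_le_iff]
    exact ⟨h1', h2', h3', h4'⟩

/-- The code is a digit prefix: it is locally constant on `digitSet` because digits are continuous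
there, and it determines the point up to `2 * tailRadius n`. -/
lemma exists_code_digitSet {ε : ℝ} (hε : 0 < ε) : ∃ c : ℝ → ℕ, ContinuousOn c digitSet ∧
    ∀ x ∈ digitSet, ∀ y ∈ digitSet, c x = c y → |x - y| < ε := by
  have := (tendsto_tailRadius.const_mul 2).eventually_lt_const (by simpa using hε)
  obtain ⟨n, hn⟩ := this.exists
  refine ⟨fun x => Encodable.encode fun i : Fin n => digits x i, ?_, fun x hx y hy h => ?_⟩
  · refine (continuous_of_discreteTopology (f := fun σ : Fin n → ℤ =>
      Encodable.encode σ)).comp_continuousOn ?_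
    exact continuousOn_pi.2 fun i => (continuous_apply (i : ℕ)).comp_continuousOn continuousOn_digits
  · have h1 := Encodable.encode_injective h
    have h2 := abs_digitReal_sub_le (digits_mem hx) (digits_mem hy) (n := n)
      fun i hi => congrFun h1 ⟨i, hi⟩
    rw [digitReal_digits hx, digitReal_digits hy] at h2
    exact h2.trans_lt hn

/-! ### The space `C¹([0,1])`. -/

open scoped Polynomial

/-- In integral form the condition is visibly closed under uniform convergence of the pair. The
resulting completeness of `C1Unit` makes the Baire category theorem available. -/
lemma hasDerivWithinAt_Icc_iff_eq_integral (p : C(Icc (0 : ℝ) 1, ℝ) × C(Icc (0 : ℝ) 1, ℝ)) :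
    (∀ x : Icc (0 : ℝ) 1,
      HasDerivWithinAt (IccExtend zero_le_one p.1) (p.2 x) (Icc (0 : ℝ) 1) (x : ℝ)) ↔
    ∀ x : Icc (0 : ℝ) 1, p.1 x = p.1 0 + ∫ t in (0 : ℝ)..x, IccExtend zero_le_one p.2 t := by
  have hc1 : Continuous (IccExtend zero_le_one p.1) := p.1.continuous.Icc_extend'
  have hc2 : Continuous (IccExtend zero_le_one p.2) := p.2.continuous.Icc_extend'
  constructor
  · intro h x
    have := intervalIntegral.integral_eq_sub_of_hasDerivAt_of_le (a := 0) (b := x)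
      (f := IccExtend zero_le_one p.1) (f' := IccExtend zero_le_one p.2) x.2.1 hc1.continuousOn
      (fun t ht => ?_) (hc2.intervalIntegrable _ _)
    · rw [this, IccExtend_val, IccExtend_left]
      simp
    · have ht1 : t ∈ Icc (0 : ℝ) 1 := ⟨ht.1.le, ht.2.le.trans x.2.2⟩
      rw [IccExtend_of_mem _ _ ht1]
      exact (h ⟨t, ht1⟩).hasDerivAt (Icc_mem_nhds ht.1 (ht.2.trans_le x.2.2))
  · intro h x
    have h1 := ((hc2.integral_hasStrictDerivAt 0 (x : ℝ)).hasDerivAt.const_add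
      (p.1 0)).hasDerivWithinAt (s := Icc (0 : ℝ) 1)
    rw [IccExtend_val] at h1
    refine h1.congr (fun t ht => ?_) ?_
    · rw [IccExtend_of_mem _ _ ht, h ⟨t, ht⟩]
    · rw [IccExtend_val, h x]

instance : CompleteSpace C1Unit := by
  refine IsClosed.completeSpace_coe (s := {p : C(Icc (0 : ℝ) 1, ℝ) × C(Icc (0 : ℝ) 1, ℝ) |
    ∀ x : Icc (0 : ℝ) 1,
      HasDerivWithinAt (IccExtend zero_le_one p.1) (p.2 x) (Icc (0 : ℝ) 1) (x : ℝ)}) (hs := ?_)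
  simp only [hasDerivWithinAt_Icc_iff_eq_integral, ofPred_forall]
  refine isClosed_iInter fun x => isClosed_eq (by fun_prop) ((by fun_prop : Continuous _).add ?_)
  have hint : ∀ f : C(Icc (0 : ℝ) 1, ℝ),
      IntervalIntegrable (IccExtend zero_le_one f) volume 0 (x : ℝ) :=
    fun f => f.continuous.Icc_extend'.intervalIntegrable _ _
  have hlip : LipschitzWith 1 fun f : C(Icc (0 : ℝ) 1, ℝ) =>
      ∫ t in (0 : ℝ)..x, IccExtend zero_le_one f t := by
    refine LipschitzWith.of_dist_le_mul fun f g => ?_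
    rw [dist_eq_norm, ← intervalIntegral.integral_sub (hint f) (hint g)]
    have := intervalIntegral.norm_integral_le_of_norm_le_const (a := 0) (b := (x : ℝ))
      (f := fun t => IccExtend zero_le_one f t - IccExtend zero_le_one g t) (C := dist f g)
      fun t _ => by
        rw [← dist_eq_norm]
        exact ContinuousMap.dist_apply_le_dist _
    refine this.trans ?_
    rw [sub_zero, abs_of_nonneg x.2.1, NNReal.coe_one, one_mul]
    exact mul_le_of_le_one_right dist_nonneg x.2.2
  exact hlip.continuous.comp continuous_snd

namespace C1Unit

/-- The function `h + s g`. -/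
noncomputable def addSMul (h g : C1Unit) (s : ℝ) : C1Unit :=
  ⟨(h.1.1 + s • g.1.1, h.1.2 + s • g.1.2), fun x => by
    refine ((h.2 x).add ((g.2 x).const_mul s)).congr (fun y hy => ?_) ?_
    · simp [IccExtend_of_mem _ _ hy]
    · simp⟩

lemma continuous_addSMul (h g : C1Unit) : Continuous (h.addSMul g) := by
  unfold addSMul
  fun_prop

lemma addSMul_zero (h g : C1Unit) : h.addSMul g 0 = h := by
  ext <;> simp [addSMul]

/-- A polynomial as an element of `C¹([0,1])`. -/
noncomputable def ofPolynomial (p : ℝ[X]) : C1Unit :=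
  ⟨(p.toContinuousMapOn _, p.derivative.toContinuousMapOn _), fun x => by
    refine (p.hasDerivAt (x : ℝ)).hasDerivWithinAt.congr (fun y hy => ?_) ?_
    · simp [IccExtend_of_mem _ _ hy]
    · simp⟩

lemma ofPolynomial_apply (p : ℝ[X]) (x : Icc (0 : ℝ) 1) : (ofPolynomial p).1.1 x = p.eval (x : ℝ) :=
  rfl

lemma lipschitzWith (h : C1Unit) : LipschitzWith ‖h.1.2‖₊ h.1.1 := by
  have := (convex_Icc (0 : ℝ) 1).lipschitzOnWith_of_nnnorm_hasDerivWithin_le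
    (f := IccExtend zero_le_one h.1.1) (f' := IccExtend zero_le_one h.1.2) (C := ‖h.1.2‖₊)
    (fun x hx => by simpa [IccExtend_of_mem _ _ hx] using h.2 ⟨x, hx⟩)
    (fun x hx => h.1.2.norm_coe_le_norm _)
  refine fun x y => ?_
  simpa [IccExtend_val, Subtype.edist_eq] using this x.2 y.2

/-- The difference of `h` and the identity is Lipschitz with constant `1 / 2`, so `h` shrinks
distances at most by the factor `2`. -/
lemma isBiLipschitz_of_norm_deriv_sub_one_lt {h : C1Unit} (hh : ‖h.1.2 - 1‖ < 1 / 2) :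
    h.IsBiLipschitz := by
  refine ⟨_, 2, h.lipschitzWith, AntilipschitzWith.of_le_mul_dist fun x y => ?_⟩
  have h1 := (h.addSMul (ofPolynomial Polynomial.X) (-1)).lipschitzWith.dist_le_mul x y
  have h2 : ‖(h.addSMul (ofPolynomial Polynomial.X) (-1)).1.2‖ ≤ 1 / 2 := by
    refine le_trans (le_of_eq ?_) hh.le
    congr 1
    ext t
    simp [addSMul, ofPolynomial, sub_eq_add_neg]
  have h3 : dist ((h.addSMul (ofPolynomial Polynomial.X) (-1)).1.1 x)
      ((h.addSMul (ofPolynomial Polynomial.X) (-1)).1.1 y) = |(h.1.1 x - h.1.1 y) - (x - y)| := by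
    rw [Real.dist_eq]
    congr 1
    simp [addSMul, ofPolynomial]
    ring
  rw [h3, coe_nnnorm] at h1
  have h4 : |(h.1.1 x - h.1.1 y) - ((x : ℝ) - y)| ≤ 1 / 2 * dist x y :=
    h1.trans (by gcongr)
  rw [Subtype.dist_eq, Real.dist_eq] at h4 ⊢
  rw [Real.dist_eq]
  have h5 := abs_sub_abs_le_abs_sub ((x : ℝ) - y) (h.1.1 x - h.1.1 y)
  rw [abs_sub_comm] at h4
  push_cast
  linarith

end C1Unit

/-! ### Trivial differences in typical images. -/

/-- The larger exponents agree, since `a < c` would give `4 ^ a + 4 ^ b ≤ 2 * 4 ^ a < 4 ^ c`. -/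
lemma four_pow_add_eq {a b c d : ℕ} (hba : b ≤ a) (hdc : d ≤ c) (h : 4 ^ a + 4 ^ b = 4 ^ c + 4 ^ d) :
    a = c ∧ b = d := by
  have key : ∀ {a b c d : ℕ}, b ≤ a → 4 ^ a + 4 ^ b = 4 ^ c + 4 ^ d → ¬ a < c := by
    intro a b c d hba h hac
    have h1 : 4 ^ (a + 1) ≤ 4 ^ c := Nat.pow_le_pow_right (by norm_num) hac
    have h2 : 4 ^ b ≤ 4 ^ a := Nat.pow_le_pow_right (by norm_num) hba
    have h3 : 0 < 4 ^ d := by positivity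
    have h4 : 0 < 4 ^ a := by positivity
    rw [pow_succ] at h1
    omega
  have hac : a = c := le_antisymm (not_lt.1 (key hdc h.symm)) (not_lt.1 (key hba h))
  subst hac
  exact ⟨rfl, Nat.pow_right_injective (le_refl 4 |>.trans' (by norm_num)) (by
    simpa using h)⟩

lemma one_le_abs_four_pow_sub {i j k l : ℕ} (hij : i ≠ j) (hik : i ≠ k) :
    (1 : ℝ) ≤ |4 ^ i - 4 ^ j - 4 ^ k + 4 ^ l| := by
  have h : (4 ^ i - 4 ^ j - 4 ^ k + 4 ^ l : ℤ) ≠ 0 := by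
    intro h0
    have h1 : (4 : ℕ) ^ i + 4 ^ l = 4 ^ j + 4 ^ k := by zify; linarith
    rcases le_total l i with h2 | h2 <;> rcases le_total k j with h3 | h3
    · exact hij (four_pow_add_eq h2 h3 h1).1
    · exact hik (four_pow_add_eq h2 h3 (by omega)).1
    · exact hik (four_pow_add_eq h2 h3 (by omega)).2
    · exact hij (four_pow_add_eq h2 h3 (by omega)).2
  exact_mod_cast Int.one_le_abs h

/-- The second difference `g x - g y - g u + g v`. -/
def quadDiff {X : Type*} (g : X → ℝ) (q : X × X × X × X) : ℝ :=
  g q.1 - g q.2.1 - g q.2.2.1 + g q.2.2.2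

lemma abs_quadDiff_sub_le {X : Type*} [PseudoMetricSpace X] {g : X → ℝ} {K : ℝ≥0}
    (hg : LipschitzWith K g) (q q' : X × X × X × X) :
    |quadDiff g q - quadDiff g q'| ≤ 4 * K * dist q q' := by
  obtain ⟨x, y, u, v⟩ := q
  obtain ⟨x', y', u', v'⟩ := q'
  have hx : dist x x' ≤ dist (x, y, u, v) (x', y', u', v') := le_max_left _ _
  have hy : dist y y' ≤ dist (x, y, u, v) (x', y', u', v') :=
    (le_max_left _ _).trans (le_max_right _ _)
  have hu : dist u u' ≤ dist (x, y, u, v) (x', y', u', v') :=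
    (le_max_left _ _).trans ((le_max_right _ _).trans (le_max_right _ _))
  have hv : dist v v' ≤ dist (x, y, u, v) (x', y', u', v') :=
    (le_max_right _ _).trans ((le_max_right _ _).trans (le_max_right _ _))
  have key : ∀ s t : X, dist s t ≤ dist (x, y, u, v) (x', y', u', v') →
      |g s - g t| ≤ K * dist (x, y, u, v) (x', y', u', v') := fun s t h =>
    (hg.dist_le_mul s t).trans (by gcongr)
  have h1 := abs_le.1 (key _ _ hx)
  have h2 := abs_le.1 (key _ _ hy)
  have h3 := abs_le.1 (key _ _ hu)
  have h4 := abs_le.1 (key _ _ hv)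
  simp only [quadDiff]
  rw [abs_le]
  constructor <;> linarith [h1.1, h1.2, h2.1, h2.2, h3.1, h3.2, h4.1, h4.2]

/-- Quadruples in `E` whose first point has distance at least `ε` from the second and third. -/
def sepQuads (E : Set ℝ) (ε : ℝ) :
    Set (Icc (0 : ℝ) 1 × Icc (0 : ℝ) 1 × Icc (0 : ℝ) 1 × Icc (0 : ℝ) 1) :=
  {q | ((q.1 : ℝ) ∈ E ∧ (q.2.1 : ℝ) ∈ E ∧ (q.2.2.1 : ℝ) ∈ E ∧ (q.2.2.2 : ℝ) ∈ E) ∧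
    ε ≤ dist q.1 q.2.1 ∧ ε ≤ dist q.1 q.2.2.1}

lemma isCompact_sepQuads {E : Set ℝ} (hE : IsCompact E) (ε : ℝ) : IsCompact (sepQuads E ε) := by
  have hdist : ∀ f : Icc (0 : ℝ) 1 × Icc (0 : ℝ) 1 × Icc (0 : ℝ) 1 × Icc (0 : ℝ) 1 → Icc (0 : ℝ) 1,
      Continuous f → IsClosed {q | ε ≤ dist q.1 (f q)} := fun f hf =>
    isClosed_le continuous_const (continuous_fst.dist hf)
  have hmem : ∀ f : Icc (0 : ℝ) 1 × Icc (0 : ℝ) 1 × Icc (0 : ℝ) 1 × Icc (0 : ℝ) 1 → Icc (0 : ℝ) 1,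
      Continuous f → IsClosed {q | (f q : ℝ) ∈ E} := fun f hf =>
    hE.isClosed.preimage (continuous_subtype_val.comp hf)
  exact (((hmem _ (by fun_prop)).inter ((hmem _ (by fun_prop)).inter
    ((hmem _ (by fun_prop)).inter (hmem _ (by fun_prop))))).inter
      ((hdist _ (by fun_prop)).inter (hdist _ (by fun_prop)))).isCompact

lemma isOpen_forall_quadDiff_ne_zero {E : Set ℝ} (hE : IsCompact E) (ε : ℝ) :
    IsOpen {h : C1Unit | ∀ q ∈ sepQuads E ε, quadDiff h.1.1 q ≠ 0} := by
  refine isOpen_iff_mem_nhds.2 fun h hh => ?_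
  refine (isCompact_sepQuads hE ε).eventually_forall_of_forall_eventually fun q hq => ?_
  have hc : Continuous fun z : C1Unit × (Icc (0 : ℝ) 1 × Icc (0 : ℝ) 1 × Icc (0 : ℝ) 1 ×
      Icc (0 : ℝ) 1) => quadDiff z.1.1.1 z.2 := by
    unfold quadDiff
    fun_prop
  exact hc.continuousAt.eventually_ne (hh q hq)

lemma hausdorffMeasure_sepQuads {E : Set ℝ} (hE : μH[1] (E ×ˢ E ×ˢ E ×ˢ E) = 0) (ε : ℝ) :
    μH[1] (sepQuads E ε) = 0 := by
  let ι : Icc (0 : ℝ) 1 × Icc (0 : ℝ) 1 × Icc (0 : ℝ) 1 × Icc (0 : ℝ) 1 → ℝ × ℝ × ℝ × ℝ :=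
    fun q => (q.1, q.2.1, q.2.2.1, q.2.2.2)
  have hι : Isometry ι := fun q q' => rfl
  rw [← hι.hausdorffMeasure_image (Or.inl zero_le_one)]
  refine measure_mono_null ?_ hE
  rintro _ ⟨q, hq, rfl⟩
  exact ⟨hq.1.1, hq.1.2.1, hq.1.2.2.1, hq.1.2.2.2⟩

/-- The function `4 ^ c` is continuous on `E` and its second differences at separated quadruples are
nonzero integers. Extend it by Tietze and approximate by a polynomial within `1 / 8`; four such
errors cost at most `1 / 2`. -/
lemma exists_polynomial_quadDiff {E : Set ℝ} (hEc : IsCompact E) {ε : ℝ}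
    {c : ℝ → ℕ} (hc : ContinuousOn c E) (hcε : ∀ x ∈ E, ∀ y ∈ E, c x = c y → |x - y| < ε) :
    ∃ g : C1Unit, ∀ q ∈ sepQuads E ε, 1 / 2 ≤ |quadDiff g.1.1 q| := by
  have hψ : Continuous fun x : E => (4 : ℝ) ^ c x :=
    (continuous_of_discreteTopology (f := fun n : ℕ => (4 : ℝ) ^ n)).comp
      (continuousOn_iff_continuous_domRestrict.1 hc)
  obtain ⟨G, hG⟩ := ContinuousMap.exists_restrict_eq hEc.isClosed ⟨_, hψ⟩
  have hGE : ∀ x ∈ E, G x = 4 ^ c x := fun x hx => DFunLike.congr_fun hG ⟨x, hx⟩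
  obtain ⟨p, hp⟩ := exists_polynomial_near_of_continuousOn 0 1 G G.continuous.continuousOn (1 / 8)
    (by norm_num)
  refine ⟨C1Unit.ofPolynomial p, ?_⟩
  rintro ⟨x, y, u, v⟩ ⟨⟨hx, hy, hu, hv⟩, hxy, hxu⟩
  simp only at hx hy hu hv hxy hxu
  have h1 : c x ≠ c y := fun h => absurd (hcε x hx y hy h) (not_lt.2 hxy)
  have h2 : c x ≠ c u := fun h => absurd (hcε x hx u hu h) (not_lt.2 hxu)
  have h3 := one_le_abs_four_pow_sub h1 h2 (l := c v)
  have e1 := abs_lt.1 (hp x x.2)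
  have e2 := abs_lt.1 (hp y y.2)
  have e3 := abs_lt.1 (hp u u.2)
  have e4 := abs_lt.1 (hp v v.2)
  rw [hGE _ hx] at e1
  rw [hGE _ hy] at e2
  rw [hGE _ hu] at e3
  rw [hGE _ hv] at e4
  simp only [quadDiff, C1Unit.ofPolynomial_apply]
  rcases le_abs.1 h3 with h | h
  · refine le_abs.2 (Or.inl ?_); linarith [e1.1, e2.2, e3.2, e4.1]
  · refine le_abs.2 (Or.inr ?_); linarith [e1.2, e2.1, e3.1, e4.2]

/-- The image consists of the parameters `s` for which `h + s g` has a vanishing second difference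
at some separated quadruple. The quotient is Lipschitz because its denominator stays away from `0`,
and the separated quadruples form an `ℋ¹`-null set. -/
lemma volume_image_quotient_eq_zero {E : Set ℝ} (hE : μH[1] (E ×ˢ E ×ˢ E ×ˢ E) = 0) {ε : ℝ}
    (h : C1Unit) {g : C1Unit} (hg : ∀ q ∈ sepQuads E ε, 1 / 2 ≤ |quadDiff g.1.1 q|) :
    volume ((fun q => -quadDiff h.1.1 q / quadDiff g.1.1 q) '' sepQuads E ε) = 0 := by
  have hbd : ∀ q, |quadDiff h.1.1 q| ≤ 4 * ‖h.1.1‖ := by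
    intro q
    have key : ∀ x, |h.1.1 x| ≤ ‖h.1.1‖ := h.1.1.norm_coe_le_norm
    have h1 := abs_le.1 (key q.1)
    have h2 := abs_le.1 (key q.2.1)
    have h3 := abs_le.1 (key q.2.2.1)
    have h4 := abs_le.1 (key q.2.2.2)
    rw [abs_le, quadDiff]
    constructor <;> linarith [h1.1, h1.2, h2.1, h2.2, h3.1, h3.2, h4.1, h4.2]
  have hlip : LipschitzOnWith (8 * ‖h.1.2‖₊ + 64 * ‖h.1.1‖₊ * ‖g.1.2‖₊)
      (fun q => -quadDiff h.1.1 q / quadDiff g.1.1 q) (sepQuads E ε) := by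
    refine LipschitzOnWith.of_dist_le_mul fun q hq q' hq' => ?_
    have hh := abs_quadDiff_sub_le h.lipschitzWith q q'
    have hgg := abs_quadDiff_sub_le g.lipschitzWith q q'
    have hb := hbd q'
    have h1 := hg q hq
    have h2 := hg q' hq'
    rw [Real.dist_eq]
    push_cast
    rw [coe_nnnorm] at hh hgg
    set A := quadDiff h.1.1 q
    set A' := quadDiff h.1.1 q'
    set P := quadDiff g.1.1 q
    set P' := quadDiff g.1.1 q'
    have hP : P ≠ 0 := by intro h0; rw [h0] at h1; norm_num at h1
    have hP' : P' ≠ 0 := by intro h0; rw [h0] at h2; norm_num at h2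
    have e : -A / P - -A' / P' = (A' - A) / P + A' * (P - P') / (P * P') := by
      field_simp; ring
    have i1 : |(A' - A) / P| ≤ 2 * |A - A'| := by
      rw [abs_div, abs_sub_comm, div_le_iff₀ (abs_pos.2 hP)]
      nlinarith [abs_nonneg (A - A')]
    have i2 : |A' * (P - P') / (P * P')| ≤ 4 * (|A'| * |P - P'|) := by
      rw [abs_div, abs_mul, abs_mul, div_le_iff₀ (mul_pos (abs_pos.2 hP) (abs_pos.2 hP'))]
      have : 1 / 4 ≤ |P| * |P'| := by nlinarith
      nlinarith [mul_nonneg (abs_nonneg A') (abs_nonneg (P - P'))]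
    have i3 : |A'| * |P - P'| ≤ 4 * ‖h.1.1‖ * (4 * ‖g.1.2‖ * dist q q') := by gcongr
    rw [e]
    refine (abs_add_le _ _).trans ?_
    nlinarith
  have := hlip.hausdorffMeasure_image_le (d := 1) zero_le_one
  rw [hausdorffMeasure_sepQuads hE, mul_zero, hausdorffMeasure_real] at this
  exact le_antisymm this zero_le

/-- For a compact set with `ℋ¹(E⁴) = 0` which has continuous codes of arbitrarily fine resolution,
the image under a typical `C¹` function has only trivial differences. -/
theorem eventually_residual_onlyTrivialDifferences {E : Set ℝ} (hEc : IsCompact E)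
    (hE4 : μH[1] (E ×ˢ E ×ˢ E ×ˢ E) = 0)
    (hcode : ∀ ε > 0, ∃ c : ℝ → ℕ, ContinuousOn c E ∧
      ∀ x ∈ E, ∀ y ∈ E, c x = c y → |x - y| < ε) :
    ∀ᶠ h in residual C1Unit, OnlyTrivialDifferences (h.img E) := by
  have hmem : ∀ n : ℕ, ∀ᶠ h in residual C1Unit,
      ∀ q ∈ sepQuads E (1 / (n + 1)), quadDiff h.1.1 q ≠ 0 := by
    intro n
    refine residual_of_dense_open (isOpen_forall_quadDiff_ne_zero hEc _) ?_
    obtain ⟨c, hc, hcε⟩ := hcode (1 / (n + 1)) (by positivity)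
    obtain ⟨g, hg⟩ := exists_polynomial_quadDiff hEc hc hcε
    refine dense_iff_inter_open.2 fun O hO ⟨h, hh⟩ => ?_
    have hOs : IsOpen {s : ℝ | h.addSMul g s ∈ O} := hO.preimage (h.continuous_addSMul g)
    have hpos := hOs.measure_pos volume ⟨0, by
      change h.addSMul g 0 ∈ O
      rwa [C1Unit.addSMul_zero]⟩
    have hnull := volume_image_quotient_eq_zero hE4 h hg
    -- The admissible `s` form an open set containing `0`, hence of positive length, so one of them
    -- is not bad.
    obtain ⟨s, hs, hs'⟩ := not_subset.1 fun hsub => hpos.ne' (measure_mono_null hsub hnull)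
    refine ⟨h.addSMul g s, hs, fun q hq h0 => hs' ⟨q, hq, ?_⟩⟩
    have hne : quadDiff g.1.1 q ≠ 0 := by
      intro h1
      have := hg q hq
      rw [h1] at this
      norm_num at this
    have h1 : quadDiff (h.addSMul g s).1.1 q = quadDiff h.1.1 q + s * quadDiff g.1.1 q := by
      simp only [quadDiff, C1Unit.addSMul, ContinuousMap.add_apply, ContinuousMap.smul_apply,
        smul_eq_mul]
      ring
    change -_ / _ = _
    rw [div_eq_iff hne]
    linarith
  filter_upwards [eventually_countable_forall.2 hmem] with h hh
  rintro _ ⟨x, hx, rfl⟩ _ ⟨y, hy, rfl⟩ _ ⟨u, hu, rfl⟩ _ ⟨v, hv, rfl⟩ heq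
  by_contra hcon
  have hxu : x ≠ u := by
    rintro rfl
    exact hcon (Or.inl ⟨rfl, by linarith⟩)
  have hxy : x ≠ y := by
    rintro rfl
    exact hcon (Or.inr ⟨rfl, by linarith⟩)
  obtain ⟨n, hn⟩ := exists_nat_one_div_lt (lt_min (dist_pos.2 hxy) (dist_pos.2 hxu))
  refine hh n (x, y, u, v) ⟨⟨hx, hy, hu, hv⟩, ?_, ?_⟩ ?_
  · exact hn.le.trans (min_le_left _ _)
  · exact hn.le.trans (min_le_right _ _)
  · simp only [quadDiff]; linarith

/-- A dense set meets the nonempty open set of functions with derivative near `1`, which contains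
the identity. -/
lemma exists_isBiLipschitz_of_eventually_residual {P : C1Unit → Prop}
    (hP : ∀ᶠ h in residual C1Unit, P h) : ∃ f : C1Unit, f.IsBiLipschitz ∧ P f := by
  have hd : Dense {h | P h} := dense_of_mem_residual hP
  have ho : IsOpen {h : C1Unit | ‖h.1.2 - 1‖ < 1 / 2} :=
    isOpen_lt (by fun_prop) continuous_const
  obtain ⟨f, hf, hf'⟩ := hd.inter_open_nonempty _ ho ⟨C1Unit.ofPolynomial Polynomial.X, by
    change ‖_ - _‖ < _
    have : (C1Unit.ofPolynomial Polynomial.X).1.2 = 1 := by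
      ext t; simp [C1Unit.ofPolynomial]
    rw [this]; norm_num⟩
  exact ⟨f, C1Unit.isBiLipschitz_of_norm_deriv_sub_one_lt hf, hf'⟩

/-! ### Hausdorff measures and bi-Lipschitz maps of the line. -/

lemma gaugeHausdorff_isAddLeftInvariant (g : ℝ≥0 → ℝ≥0) :
    (gaugeHausdorff g).IsAddLeftInvariant := by
  refine forall_measure_preimage_add_iff _ |>.1 fun c s _ => ?_
  have h := OuterMeasure.isometryEquiv_comap_mkMetric
    (fun d : ℝ≥0∞ => (g d.toNNReal : ℝ≥0∞)) (IsometryEquiv.addLeft c)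
  have h2 := DFunLike.congr_fun h ((fun x => c + x) ⁻¹' s)
  rw [OuterMeasure.comap_apply, OuterMeasure.coe_mkMetric] at h2
  rw [gaugeHausdorff, ← h2]
  congr 1
  exact image_preimage_eq s (IsometryEquiv.addLeft c).surjective

lemma exists_nat_mul_le_le {N : ℕ} (hN : 0 < N) {d s : ℝ} (h0 : 0 ≤ s) (h : s ≤ N * d) :
    ∃ i < N, i * d ≤ s ∧ s ≤ (i + 1) * d := by
  induction N, hN using Nat.le_induction with
  | base => exact ⟨0, by simp, by simpa using h0, by simpa using h⟩
  | succ N hN ih =>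
    rcases le_total s (N * d) with hs | hs
    · obtain ⟨i, hi, h1, h2⟩ := ih hs
      exact ⟨i, by omega, h1, h2⟩
    · exact ⟨N, by omega, hs, by simpa using h⟩

/-- On the line a Lipschitz map increases a Hausdorff measure at most by a constant factor, for
every gauge function: the image of a set of diameter `d` is covered by boundedly many intervals of
length `d`. -/
lemma gaugeHausdorff_image_le (g : ℝ≥0 → ℝ≥0) {N : ℕ} (hN : 0 < N) {φ : ℝ → ℝ} {A : Set ℝ}
    (hφ : LipschitzOnWith N φ A) : gaugeHausdorff g (φ '' A) ≤ N * gaugeHausdorff g A := by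
  by_cases htop : gaugeHausdorff g A = ∞
  · rw [htop, ENNReal.mul_top (by exact_mod_cast hN.ne')]
    exact le_top
  set m : ℝ≥0∞ → ℝ≥0∞ := fun d => (g d.toNNReal : ℝ≥0∞) with hm
  let r : ℕ → ℝ≥0∞ := fun n => ((n + 1 : ℕ) : ℝ≥0∞)⁻¹
  have hr0 : ∀ n, 0 < r n := fun n => ENNReal.inv_pos.2 (ENNReal.natCast_ne_top _)
  have hrtop : ∀ n, r n ≠ ∞ := fun n => ENNReal.inv_ne_top.2 (by simp)
  have hr : Tendsto r atTop (𝓝 0) :=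
    ENNReal.tendsto_inv_nat_nhds_zero.comp (tendsto_add_atTop_nat 1)
  have hcov : ∀ n, ∃ t : ℕ → Set ℝ, A ⊆ iUnion t ∧ (∀ k, Metric.ediam (t k) ≤ r n) ∧
      ∑' k, ⨆ (_ : (t k).Nonempty), m (Metric.ediam (t k)) ≤ gaugeHausdorff g A + r n := by
    intro n
    have h1 : (⨅ (t : ℕ → Set ℝ) (_ : A ⊆ iUnion t) (_ : ∀ k, Metric.ediam (t k) ≤ r n),
        ∑' k, ⨆ (_ : (t k).Nonempty), m (Metric.ediam (t k))) < gaugeHausdorff g A + r n := by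
      refine lt_of_le_of_lt ?_ (ENNReal.lt_add_right htop (hr0 n).ne')
      rw [gaugeHausdorff, Measure.mkMetric_apply]
      exact le_iSup₂ (f := fun (r : ℝ≥0∞) (_ : 0 < r) => ⨅ (t : ℕ → Set ℝ) (_ : A ⊆ iUnion t)
        (_ : ∀ k, Metric.ediam (t k) ≤ r), ∑' k, ⨆ (_ : (t k).Nonempty), m (Metric.ediam (t k)))
        (r n) (hr0 n)
    simp only [iInf_lt_iff] at h1
    obtain ⟨t, h2, h3, h4⟩ := h1
    exact ⟨t, h2, h3, h4.le⟩
  choose t htA htr hts using hcov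
  let d : ℕ → ℕ → ℝ := fun n k => (Metric.ediam (t n k)).toReal
  let c : ℕ → ℕ → ℝ := fun n k => sInf (φ '' (t n k ∩ A))
  -- The image of `t n k ∩ A` lies in an interval of length `N * d n k`, cut here into `N` intervals
  -- with exactly the diameter of `t n k`; thus no doubling condition on `g` is needed. Empty `t n
  -- k` are dropped, since an interval replacing one would cost `g 0`, which may be positive.
  let T : ∀ n, {k // (t n k).Nonempty} × Fin N → Set ℝ := fun n p =>
    Icc (c n p.1 + (p.2 : ℕ) * d n p.1) (c n p.1 + ((p.2 : ℕ) + 1) * d n p.1)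
  have hfin : ∀ n k, Metric.ediam (t n k) ≠ ∞ := fun n k => ne_top_of_le_ne_top (hrtop n) (htr n k)
  have hTdiam : ∀ n p, Metric.ediam (T n p) = Metric.ediam (t n p.1) := by
    intro n p
    simp only [T]
    rw [Real.ediam_Icc, ← ENNReal.ofReal_toReal (hfin n p.1)]
    congr 1
    simp only [d]; ring
  have key := Measure.mkMetric_le_liminf_tsum (φ '' A) (l := atTop) r hr T
    (Eventually.of_forall fun n p => (hTdiam n p).trans_le (htr n p.1))
    (Eventually.of_forall fun n => ?_) m
  · refine key.trans ?_
    have hle : ∀ n, ∑' p, m (Metric.ediam (T n p)) ≤ N * (gaugeHausdorff g A + r n) := by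
      intro n
      simp only [hTdiam]
      rw [ENNReal.tsum_prod (f := fun (k : {k // (t n k).Nonempty}) (_ : Fin N) =>
        m (Metric.ediam (t n k)))]
      simp only [tsum_fintype, Finset.sum_const, Finset.card_univ, Fintype.card_fin, nsmul_eq_mul]
      rw [ENNReal.tsum_mul_left]
      gcongr
      refine le_trans ?_ (hts n)
      calc ∑' k : {k // (t n k).Nonempty}, m (Metric.ediam (t n k))
          = ∑' k : {k // (t n k).Nonempty}, ⨆ (_ : (t n k).Nonempty), m (Metric.ediam (t n k)) :=
            tsum_congr fun k => by simp [k.2]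
        _ ≤ _ := ENNReal.tsum_comp_le_tsum_of_injective Subtype.val_injective _
    have hlim : Tendsto (fun n => (N : ℝ≥0∞) * (gaugeHausdorff g A + r n)) atTop
        (𝓝 (N * (gaugeHausdorff g A + 0))) :=
      ENNReal.Tendsto.const_mul (tendsto_const_nhds.add hr) (Or.inr (ENNReal.natCast_ne_top _))
    rw [add_zero] at hlim
    rw [← hlim.liminf_eq]
    exact liminf_le_liminf (Eventually.of_forall hle)
  · rintro _ ⟨x, hx, rfl⟩
    obtain ⟨k, hk⟩ := mem_iUnion.1 (htA n hx)
    have hLip : ∀ z ∈ φ '' (t n k ∩ A), φ x - N * d n k ≤ z := by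
      rintro _ ⟨y, ⟨hy, hyA⟩, rfl⟩
      have h1 := hφ.dist_le_mul x hx y hyA
      have h2 : dist x y ≤ d n k := by
        rw [dist_edist]
        exact ENNReal.toReal_mono (hfin n k) (Metric.edist_le_ediam_of_mem hk hy)
      have h3 : |φ x - φ y| ≤ N * d n k := h1.trans (by push_cast; gcongr)
      linarith [(abs_le.1 h3).2]
    have hmem : φ x ∈ φ '' (t n k ∩ A) := ⟨x, ⟨hk, hx⟩, rfl⟩
    have h1 : c n k ≤ φ x := csInf_le ⟨_, hLip⟩ hmem
    have h2 : φ x - N * d n k ≤ c n k := le_csInf ⟨_, hmem⟩ hLip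
    obtain ⟨i, hi, h3, h4⟩ := exists_nat_mul_le_le hN (d := d n k) (s := φ x - c n k)
      (by linarith) (by linarith)
    exact mem_iUnion.2 ⟨⟨⟨k, ⟨x, hk⟩⟩, ⟨i, hi⟩⟩, by
      simp only [T]; constructor <;> linarith⟩

/-- If `A` is measured by a Hausdorff measure and is mapped bi-Lipschitz into the measurable set `E`,
then the image is contained in a measured subset of `E`. -/
lemma MeasuredByHausdorff.exists_measured_superset_image {A E : Set ℝ} (hA : MeasuredByHausdorff A)
    (hE : MeasurableSet E) {φ ψ : ℝ → ℝ} {N : ℕ} (hN : 0 < N) (hψ : LipschitzOnWith N ψ A)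
    (hψE : MapsTo ψ A E) (hφ : LipschitzOnWith N φ (ψ '' A)) (hinv : LeftInvOn φ ψ A) :
    ∃ B, Measured B ∧ ψ '' A ⊆ B ∧ B ⊆ E := by
  obtain ⟨g, -, hpos, hsf⟩ := hA
  set H := gaugeHausdorff g with hH
  let S := spanningSets (H.restrict A)
  have hS : ∀ n, H (S n ∩ A) < ∞ := fun n => by
    rw [← Measure.restrict_apply (measurableSet_spanningSets _ n)]
    exact measure_spanningSets_lt_top _ n
  -- The set `A` need not be measurable, so measurable hulls of the images of its pieces of finite
  -- measure are taken and cut down to `E`.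
  let B : ℕ → Set ℝ := fun n => toMeasurable H (ψ '' (S n ∩ A)) ∩ E
  have hBmeas : ∀ n, MeasurableSet (B n) := fun n => (measurableSet_toMeasurable _ _).inter hE
  have hBfin : ∀ n, H (B n) < ∞ := fun n => by
    refine (measure_mono inter_subset_left).trans_lt ?_
    rw [measure_toMeasurable]
    exact (gaugeHausdorff_image_le g hN (hψ.mono inter_subset_right)).trans_lt
      (ENNReal.mul_lt_top (ENNReal.natCast_lt_top _) (hS n))
  have hsub : ψ '' A ⊆ ⋃ n, B n := by
    rintro _ ⟨x, hx, rfl⟩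
    have hxS : x ∈ ⋃ n, S n := by rw [iUnion_spanningSets]; trivial
    obtain ⟨n, hn⟩ := mem_iUnion.1 hxS
    exact mem_iUnion.2 ⟨n, subset_toMeasurable _ _ ⟨x, ⟨hn, hx⟩, rfl⟩, hψE hx⟩
  have hUmeas : MeasurableSet (⋃ n, B n) := MeasurableSet.iUnion hBmeas
  refine ⟨⋃ n, B n, ⟨hUmeas, H, gaugeHausdorff_isAddLeftInvariant g, ?_, ?_⟩, hsub,
    iUnion_subset fun n => inter_subset_right⟩
  -- If the hull were null, then so would be `ψ '' A`, and hence its Lipschitz image `A` under `φ`.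
  · refine pos_iff_ne_zero.2 fun h0 => hpos.ne' ?_
    have h1 := gaugeHausdorff_image_le g hN hφ
    rw [← hH, measure_mono_null hsub h0, mul_zero, hinv.image_image] at h1
    exact le_antisymm h1 zero_le
  · refine Measure.sigmaFinite_of_countable (S := insert (⋃ n, B n)ᶜ (range B))
      ((countable_range B).insert _) ?_ ?_
    · rintro s (rfl | ⟨n, rfl⟩)
      · rw [Measure.restrict_apply hUmeas.compl, compl_inter_self]; simp
      · exact (Measure.restrict_apply_le _ _).trans_lt (hBfin n)
    · rw [sUnion_insert, sUnion_range, compl_union_self]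

/-- The bi-Lipschitz image of a measurable set which is not a union of countably many measured sets
is not a union of countably many sets measured by Hausdorff measures. -/
lemma not_isCountableUnionOf_measuredByHausdorff_img {E : Set ℝ} (hE : MeasurableSet E)
    (hE1 : E ⊆ Icc 0 1) (hEm : ¬ IsCountableUnionOf Measured E) {f : C1Unit}
    (hf : f.IsBiLipschitz) : ¬ IsCountableUnionOf MeasuredByHausdorff (f.img E) := by
  rintro ⟨𝒜, hc, hm, hU⟩
  obtain ⟨K, L, hK, hL⟩ := hf
  obtain ⟨N, hN⟩ := exists_nat_ge (max K L)
  have hN1 : 0 < N + 1 := N.succ_pos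
  have hKN : K ≤ ((N + 1 : ℕ) : ℝ≥0) := (le_max_left _ _).trans (hN.trans (by simp))
  have hLN : L ≤ ((N + 1 : ℕ) : ℝ≥0) := (le_max_right _ _).trans (hN.trans (by simp))
  let φ : ℝ → ℝ := IccExtend zero_le_one f.1.1
  let ψ : ℝ → ℝ := fun y => (Function.invFun f.1.1 y : Icc (0 : ℝ) 1)
  have hleft : ∀ x, ψ (f.1.1 x) = x := fun x => by
    simp only [ψ]; rw [Function.leftInverse_invFun hL.injective x]
  have hφ : LipschitzOnWith ((N + 1 : ℕ) : ℝ≥0) φ (Icc 0 1) := by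
    intro x hx y hy
    simp only [φ, IccExtend_of_mem _ _ hx, IccExtend_of_mem _ _ hy]
    exact (hK.weaken hKN) ⟨x, hx⟩ ⟨y, hy⟩
  have hψ : LipschitzOnWith ((N + 1 : ℕ) : ℝ≥0) ψ (f.img E) := by
    rintro _ ⟨x, hx, rfl⟩ _ ⟨y, hy, rfl⟩
    rw [hleft, hleft]
    exact (hL x y).trans (by gcongr)
  have hsubset : ∀ A ∈ 𝒜, A ⊆ f.img E := fun A hA => hU ▸ subset_sUnion_of_mem hA
  have hmaps : MapsTo ψ (f.img E) E := by
    rintro _ ⟨x, hx, rfl⟩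
    rw [hleft]; exact hx
  have hB : ∀ A : 𝒜, ∃ B, Measured B ∧ ψ '' A ⊆ B ∧ B ⊆ E := fun A => by
    refine (hm A A.2).exists_measured_superset_image hE hN1 (hψ.mono (hsubset A A.2))
      (hmaps.mono_left (hsubset A A.2)) (φ := φ) (hφ.mono ?_) ?_
    · rintro _ ⟨y, hy, rfl⟩
      exact hE1 (hmaps (hsubset A A.2 hy))
    · intro y hy
      obtain ⟨x, hx, rfl⟩ := hsubset A A.2 hy
      rw [hleft]
      exact IccExtend_val _ _ _
  choose B hBm hAB hBE using hB
  have := hc.to_subtype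
  refine hEm ⟨range B, countable_range B, by rintro _ ⟨A, rfl⟩; exact hBm A, ?_⟩
  refine subset_antisymm (sUnion_subset (by rintro _ ⟨A, rfl⟩; exact hBE A)) fun x hx => ?_
  have hmem : f.1.1 ⟨x, hE1 hx⟩ ∈ ⋃₀ 𝒜 := by
    rw [hU]; exact ⟨⟨x, hE1 hx⟩, hx, rfl⟩
  obtain ⟨A, hA, hxA⟩ := hmem
  exact ⟨B ⟨A, hA⟩, ⟨_, rfl⟩, hAB ⟨A, hA⟩ ⟨_, hxA, hleft _⟩⟩

/-! ### Invariant measures from trivial differences, and the conclusion. -/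

/-- A countable set is a union of countably many measured sets, namely singletons. -/
lemma Set.Countable.isCountableUnionOf_measured {E : Set ℝ} (hE : E.Countable) :
    IsCountableUnionOf Measured E := by
  refine ⟨(fun x => {x}) '' E, hE.image _, ?_, by simp⟩
  rintro _ ⟨x, -, rfl⟩
  refine ⟨measurableSet_singleton x, Measure.count, inferInstance, by simp, ?_⟩
  have : IsFiniteMeasure ((Measure.count : Measure ℝ).restrict {x}) := ⟨by simp⟩
  infer_instance

/-- An uncountable compact set with only trivial differences is measured: the translates of a
diffuse measure on it add up to a translation invariant measure. -/
lemma OnlyTrivialDifferences.measured {K : Set ℝ} (hK : OnlyTrivialDifferences K)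
    (hKc : IsCompact K) (hunc : ¬ K.Countable) : Measured K := by
  have hKm : MeasurableSet K := hKc.measurableSet
  have : StandardBorelSpace K := hKm.standardBorel
  let e : K ≃ᵐ ℝ := PolishSpace.measurableEquivOfNotCountable hunc
    (not_countable_iff.2 inferInstance)
  let j : ℝ → ℝ := fun t => e.symm t
  have hj : Measurable j := measurable_subtype_coe.comp e.symm.measurable
  have hjinj : Function.Injective j := Subtype.val_injective.comp e.symm.injective
  have hjK : ∀ t, j t ∈ K := fun t => (e.symm t).2
  -- A diffuse probability measure on `K`, transported from Lebesgue measure by a Borel isomorphism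
  -- of `ℝ` with `K`.
  let ν : Measure ℝ := (volume.restrict (Icc (0 : ℝ) 1)).map j
  have hνK : ν K = 1 := by
    rw [Measure.map_apply hj hKm, show j ⁻¹' K = univ from eq_univ_of_forall hjK]
    simp
  have hνsub : ∀ s : Set ℝ, s.Subsingleton → ν s = 0 := by
    intro s hs
    rw [Measure.map_apply hj hs.measurableSet]
    exact (hs.preimage hjinj).measure_zero _
  have hνc : ν Kᶜ = 0 := by
    rw [Measure.map_apply hj hKm.compl, show j ⁻¹' Kᶜ = ∅ from
      eq_empty_of_forall_notMem fun t ht => ht (hjK t)]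
    simp
  -- Summing over all real translations makes `μ` invariant by reindexing, while only `t = 0`
  -- contributes to `μ K`.
  let μ : Measure ℝ := Measure.sum fun t : ℝ => ν.map fun x => x + t
  have hμ : ∀ s, MeasurableSet s → μ s = ∑' t : ℝ, ν ((fun x => x + t) ⁻¹' s) := fun s hs => by
    rw [Measure.sum_apply _ hs]
    exact tsum_congr fun t => Measure.map_apply (measurable_add_const t) hs
  have hμK : μ K = 1 := by
    rw [hμ K hKm, tsum_eq_single 0]
    · simpa using hνK
    · intro t ht
      have h1 : ν (K ∩ (fun x => x + t) ⁻¹' K) = 0 := by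
        refine hνsub _ fun x hx y hy => ?_
        -- Two points of `K` whose translates by `t` are also in `K` realise the same difference
        -- `t`; as `t ≠ 0`, they coincide.
        have := hK (x + t) hx.2 x hx.1 (y + t) hy.2 y hy.1 (by ring)
        rcases this with h | h
        · exact h.2
        · exact absurd (by linarith [h.1]) ht
      refine measure_mono_null (t := (K ∩ (fun x => x + t) ⁻¹' K) ∪ Kᶜ) (fun x hx => ?_)
        (measure_union_null h1 hνc)
      by_cases hxK : x ∈ K
      · exact Or.inl ⟨hxK, hx⟩
      · exact Or.inr hxK
  refine ⟨hKm, μ, ?_, ?_, ?_⟩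
  · refine forall_measure_preimage_add_iff _ |>.1 fun c s hs => ?_
    rw [hμ s hs, hμ _ (measurable_const_add c hs),
      ← (Equiv.addLeft c).tsum_eq fun t => ν ((fun x => x + t) ⁻¹' s)]
    refine tsum_congr fun t => ?_
    congr 1
    ext x
    change c + (x + t) ∈ s ↔ x + (c + t) ∈ s
    rw [show c + (x + t) = x + (c + t) by ring]
  · rw [hμK]; exact one_pos
  · have : IsFiniteMeasure (μ.restrict K) := ⟨by
      rw [Measure.restrict_apply_univ, hμK]; exact ENNReal.one_lt_top⟩
    infer_instance

lemma isCompact_img (f : C1Unit) {E : Set ℝ} (hE : IsCompact E) : IsCompact (f.img E) :=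
  ((hE.isClosed.preimage continuous_subtype_val).isCompact).image f.1.1.continuous

lemma not_countable_img {f : C1Unit} (hf : f.IsBiLipschitz) {E : Set ℝ} (hE1 : E ⊆ Icc 0 1)
    (hE : ¬ E.Countable) : ¬ (f.img E).Countable := by
  obtain ⟨-, L, -, hL⟩ := hf
  intro h
  have h1 : {x : Icc (0 : ℝ) 1 | (x : ℝ) ∈ E}.Countable :=
    countable_of_injective_of_countable_image hL.injective.injOn h
  have h2 : E ⊆ Subtype.val '' {x : Icc (0 : ℝ) 1 | (x : ℝ) ∈ E} :=
    fun x hx => ⟨⟨x, hE1 hx⟩, hx, rfl⟩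
  exact hE ((h1.image Subtype.val).mono h2)

theorem theorem4p7 :
    ∃ (K E : Set ℝ) (f : C1Unit),
      (IsCompact K ∧ Measured K ∧ ¬ IsCountableUnionOf MeasuredByHausdorff K) ∧
      (E ⊆ Set.Icc 0 1 ∧ IsCompact E ∧ HasBoxDimension E 0 ∧ ¬ IsCountableUnionOf Measured E) ∧
      (f.IsBiLipschitz ∧ K = f.img E) ∧
      (∀ᶠ h in residual C1Unit, OnlyTrivialDifferences (h.img E)) := by
  have htyp := eventually_residual_onlyTrivialDifferences isCompact_digitSet
    hausdorffMeasure_one_digitSet_prod fun ε hε => exists_code_digitSet hε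
  obtain ⟨f, hf, hftriv⟩ := exists_isBiLipschitz_of_eventually_residual htyp
  have hunc : ¬ digitSet.Countable := fun h =>
    not_isCountableUnionOf_measured_digitSet h.isCountableUnionOf_measured
  have hcomp := isCompact_img f isCompact_digitSet
  exact ⟨f.img digitSet, digitSet, f,
    ⟨hcomp, hftriv.measured hcomp (not_countable_img hf digitSet_subset_Icc hunc),
      not_isCountableUnionOf_measuredByHausdorff_img isCompact_digitSet.measurableSet
        digitSet_subset_Icc not_isCountableUnionOf_measured_digitSet hf⟩,
    ⟨digitSet_subset_Icc, isCompact_digitSet, hasBoxDimension_digitSet,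
      not_isCountableUnionOf_measured_digitSet⟩,
    ⟨hf, rfl⟩, htyp⟩
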